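/- **Setting.** Let $\mathcal S\subseteq\mathbb R^{n_s}$, $\mathcal Z\subseteq\mathbb R^{n_z}$, $\mathcal A\subseteq\mathbb R^{n_a}$ be compact, and let $\dot{\mathcal S}=\mathcal S\times\mathcal Z$ be the augmented state space, with transition law $P_{\mathrm T}(\mathrm ds',\mathrm dz'\mid (s,z),a)=P_{\mathrm T}^{z}(\mathrm ds'\mid s,a)\,P_{\mathrm{shift}}(\mathrm dz'\mid z)$ and some initial law. For $k=0,\dots,K$ let $C'_k(s,a)$ be measurable costs and $V_k(\dot s)$ measurable potentials such that the reshaped costs $\dot C'_k(\dot s,a,\dot s')=C'_k(s,a)+V_k(\dot s')-V_k(\dot s)$ are bounded. Policies $\pi_\theta(a\mid\dot s)$, $\theta\in\Theta\subseteq\mathbb R^{n_\theta}$, are given by densities with respect to a finite reference measure on $\mathcal A$. Put $$\dot f_k(\theta)=\lim_{T\to\infty}\frac1T\,\mathbb E_{\pi_\theta}\Bigl[\sum_{t=0}^{T-1}\dot C'_k(\dot s_t,a_t,\dot s_{t+1})\Bigr],\qquad Q_k^{\pi_\theta}(\dot s,a)=\mathbb E_{\pi_\theta}\Bigl[\sum_{l=0}^{\infty}\bigl(\dot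 C'_{k,l}-\dot f_k(\theta)\bigr)\Bigm|\dot s_0=\dot s,a_0=a\Bigr],$$ and, for $c\in\mathbb R$, $T\in\mathbb N$, $\hat Q_k^{\pi_\theta,c,T}(\dot s,a)=\mathbb E_{\pi_\theta}\bigl[\sum_{l=0}^{T-1}(\dot C'_{k,l}-c)\mid\dot s_0=\dot s,a_0=a\bigr]$. **Assumption 1.** $\Theta$ is compact and convex with nonempty interior. The densities are positive, normalized, jointly continuous in $(\theta,\dot s,a)$ and differentiable in $\theta\in\Theta$ with a gradient that is jointly continuous, and they are Lipschitz in $\theta\in\Theta$ uniformly in $(\dot s,a)$. Each $\dot f_k$ is differentiable on $\Theta$ with bounded and Lipschitz gradient. There are $\lambda>0$ and $\rho\in(0,1)$ such that for every $\theta\in\Theta$ the chain of augmented states under $\pi_\theta$ has a stationary law $\mathbf P_{\pi_\theta}$ with $\sup_{\dot s}d_{\mathrm{TV}}\bigl(P(\dot s_t\in\cdot\mid\dot s_0=\dot s),\mathbf P_{\pi_\theta}\bigr)\le\lambda\rho^t$ for all $t\ge0$, where $d_{\mathrm{TV}}(\alpha,\beta)=\int|\alpha(\mathrm d\dot s)-\beta(\mathrm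 d\dot s)|$. **Assumption 2.** $(\mu_i)$ and $(\eta_i)$ are deterministic, positive and non-increasing, $\mu_i\le1$, $\mu_i\to0$, $\sum_i\mu_i=\infty$, $\sum_i\mu_i^2<\infty$, $\eta_i\to0$, $1/\eta_i=O(i^{\varrho})$ for some $\varrho\in(0,1)$, $\sum_i\eta_i^2<\infty$, and $\mu_i/\eta_i\to0$. **Algorithm.** Let $B\ge1$ and $\zeta_k>0$. A trajectory $\dot s_0,a_0,\dot s_1,a_1,\dots$ is generated in which the actions at times $t\in\varepsilon_i=\{iB,\dots,iB+B-1\}$ are drawn from $\pi_{\theta_i}$, where $\theta_i$ is determined by the information available before time $iB$, and $\theta_0\in\Theta$. With arbitrary initial values $\hat f_{k,0}$ (known at time $0$) and $\hat g_{k,0}$, $$\hat f_{k,i+1}=(1-\eta_{i+1})\hat f_{k,i}+\eta_i\,\frac1B\sum_{t\in\varepsilon_i}\dot C'_k(\dot s_t,a_t,\dot s_{t+1}),$$ $$\hat g_{k,i+1}=(1-\eta_{i+1})\hat g_{k,i}+\eta_i\,\frac1B\sum_{t\in\varepsilon_i}Q_{\omega_{k,i}}(\dot s_t,a_t)\,\nabla_\theta\log\pi_{\theta_i}(a_t\mid\dot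 s_t),$$ where $Q_{\omega_{k,i}}$ are Q-networks whose parameters may be updated in any way. With $\bar f_{k,i}(\theta)=\hat f_{k,i}+\hat g_{k,i}^{\mathsf T}(\theta-\theta_i)+\zeta_k\|\theta-\theta_i\|_2^2$, let $\bar\theta_i$ solve $\min_{\theta\in\Theta}\bar f_{0,i}(\theta)$ s.t. $\bar f_{k,i}(\theta)\le0$ for $k=1,\dots,K$ if this is feasible, and otherwise $\min_{\theta\in\Theta,\alpha}\alpha$ s.t. $\bar f_{k,i}(\theta)\le\alpha$ for $k=1,\dots,K$; then $\theta_{i+1}=(1-\mu_{i+1})\theta_i+\mu_{i+1}\bar\theta_i$. **Lemma 2 (asymptotic consistency of surrogate functions).** Under Assumptions 1 and 2 the limits defining $\dot f_k(\theta)$ exist and the series defining $Q_k^{\pi_\theta}$ (of the conditional expectations) converge for all $\theta\in\Theta$, and, for every $k=0,\dots,K$: 1. $\lim_{i\to\infty}\bigl|\hat f_{k,i}-\dot f_k(\theta_i)\bigr|=0$ almost surely. 2. $\limsup_{i\to\infty}\bigl\|\hat g_{k,i}-\nabla\dot f_k(\theta_i)\bigr\|_2\le\epsilon_Q$ almost surely,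 where $\epsilon_Q=C\,\limsup_{i\to\infty}\sup_{\dot s,a}\bigl|Q_{\omega_{k,i}}(\dot s,a)-\hat Q_{k,i}(\dot s,a)\bigr|$. Here $C>0$ depends only on the decision process and the policy family (not on the step sizes, $B$, the Q-networks or the run), and $\hat Q_{k,i}$ is either of the following: (a) the surrogate value function $\hat Q_{k,i}=\hat Q_k^{\pi_{\theta_i},\hat f_{k,i},T_i}$ for any deterministic horizons $T_i\to\infty$, the bound holding almost surely on the event that these functions are bounded uniformly in $i,\dot s,a$; (b) the exact value function $\hat Q_{k,i}=Q_k^{\pi_{\theta_i}}$. -/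

import Mathlib

open MeasureTheory ProbabilityTheory Filter Topology Set
open scoped ENNReal NNReal

noncomputable section

namespace CACRL

/-- The parameter-dependent constrained Markov decision process: state space `S`, latent space `Z`,
action space `A`, the transition law `P_T^z(· ∣ s, a)` of the state, the law
`P_shift(· ∣ z)` of the latent variable, the law of the initial augmented state, the instantaneous
objective/constraint costs `C'_k(s, a)`, `k = 0, …, K`, and the potentials `V_k` used for
reward-reshaping. -/
structure CMDP (nS nZ nA K : ℕ) where
  S : Set (EuclideanSpace ℝ (Fin nS))
  Z : Set (EuclideanSpace ℝ (Fin nZ))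
  A : Set (EuclideanSpace ℝ (Fin nA))
  trans : Kernel ((S × Z) × A) S
  shift : Kernel Z Z
  init : Measure (S × Z)
  cost : Fin (K + 1) → S → A → ℝ
  pot : Fin (K + 1) → S × Z → ℝ
  isMarkov_trans : IsMarkovKernel trans
  isMarkov_shift : IsMarkovKernel shift
  isProb_init : IsProbabilityMeasure init
  measurable_cost : ∀ k, Measurable (Function.uncurry (cost k))
  measurable_pot : ∀ k, Measurable (pot k)

namespace CMDP

variable {nS nZ nA K : ℕ}

/-- The augmented state space `S × Z`. -/
abbrev X (M : CMDP nS nZ nA K) : Type := M.S × M.Z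

/-- The transition kernel of the augmented CMDP,
`P_T(ds', dz' ∣ (s, z), a) = P_T^z(ds' ∣ s, a) P_shift(dz' ∣ z)`. -/
def augTrans (M : CMDP nS nZ nA K) : Kernel (M.X × M.A) M.X :=
  M.trans ×ₖ M.shift.comap (fun q : M.X × M.A => q.1.2) (measurable_snd.comp measurable_fst)

/-- The reshaped cost `C'_k(s, a) + V_k(s', z') - V_k(s, z)`. -/
def shapedCost (M : CMDP nS nZ nA K) (k : Fin (K + 1)) (x : M.X) (a : M.A) (x' : M.X) : ℝ :=
  M.cost k x.1 a + (M.pot k x' - M.pot k x)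

end CMDP

/-- A parametrized family of stochastic policies, given by densities
`dens θ x a = π_θ(a ∣ x)` with respect to a finite reference measure on the action space
(for instance Lebesgue measure on `A`). -/
structure Policy {nS nZ nA K : ℕ} (M : CMDP nS nZ nA K) (nθ : ℕ) where
  ref : Measure M.A
  isFinite_ref : IsFiniteMeasure ref
  dens : EuclideanSpace ℝ (Fin nθ) → M.X → M.A → ℝ

namespace Policy

variable {nS nZ nA K nθ : ℕ} {M : CMDP nS nZ nA K}

attribute [instance] Policy.isFinite_ref

/-- The policy as a kernel, `π_θ(da ∣ x)`. -/
def kernel (π : Policy M nθ) (θ : EuclideanSpace ℝ (Fin nθ)) : Kernel M.X M.A :=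
  (Kernel.const M.X π.ref).withDensity (fun x a => ENNReal.ofReal (π.dens θ x a))

/-- The joint law of `(a_t, x_{t+1})` given `x_t` when actions are drawn from `π_θ`. -/
def step (π : Policy M nθ) (θ : EuclideanSpace ℝ (Fin nθ)) : Kernel M.X (M.A × M.X) :=
  π.kernel θ ⊗ₖ M.augTrans

/-- The transition kernel of the Markov chain of augmented states under `π_θ`. -/
def chain (π : Policy M nθ) (θ : EuclideanSpace ℝ (Fin nθ)) : Kernel M.X M.X :=
  (π.step θ).snd

/-- The law of `x_t` given `x_0` under the fixed policy `π_θ`. -/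
def nStep (π : Policy M nθ) (θ : EuclideanSpace ℝ (Fin nθ)) : ℕ → Kernel M.X M.X
  | 0 => Kernel.id
  | t + 1 => π.chain θ ∘ₖ π.nStep θ t

/-- `𝔼[Ċ'_k(x_t, a_t, x_{t+1}) ∣ x_t = x]` under `π_θ`. -/
def meanCost (π : Policy M nθ) (k : Fin (K + 1)) (θ : EuclideanSpace ℝ (Fin nθ)) (x : M.X) : ℝ :=
  ∫ p, M.shapedCost k x p.1 p.2 ∂(π.step θ x)

/-- `T⁻¹ 𝔼[∑_{t < T} Ċ'_k(x_t, a_t, x_{t+1})]` under `π_θ`, with `x_0 ∼ M.init`. -/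
def avgCost (π : Policy M nθ) (k : Fin (K + 1)) (θ : EuclideanSpace ℝ (Fin nθ)) (T : ℕ) : ℝ :=
  (T : ℝ)⁻¹ * ∑ t ∈ Finset.range T, ∫ x₀, ∫ x, π.meanCost k θ x ∂(π.nStep θ t x₀) ∂M.init

/-- The reshaped objective/constraint function `ḟ_k(θ)`: the long-run average reshaped cost. -/
def fdot (π : Policy M nθ) (k : Fin (K + 1)) (θ : EuclideanSpace ℝ (Fin nθ)) : ℝ :=
  limUnder atTop (π.avgCost k θ)

/-- `𝔼[Ċ'_{k,l} ∣ x_0 = x, a_0 = a]` under `π_θ`. -/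
def costAt (π : Policy M nθ) (k : Fin (K + 1)) (θ : EuclideanSpace ℝ (Fin nθ)) (x : M.X) (a : M.A) :
    ℕ → ℝ
  | 0 => ∫ x', M.shapedCost k x a x' ∂(M.augTrans (x, a))
  | l + 1 => ∫ x', ∫ y, π.meanCost k θ y ∂(π.nStep θ l x') ∂(M.augTrans (x, a))

/-- The state-action value function
`Q_k^{π_θ}(x, a) = 𝔼[∑_{l ≥ 0} (Ċ'_{k,l} - ḟ_k(θ)) ∣ x_0 = x, a_0 = a]`. -/
def Q (π : Policy M nθ) (k : Fin (K + 1)) (θ : EuclideanSpace ℝ (Fin nθ)) (x : M.X) (a : M.A) : ℝ :=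
  ∑' l, (π.costAt k θ x a l - π.fdot k θ)

/-- The surrogate value function with the estimate `c` in place of `ḟ_k(θ)`, up to horizon `T`:
`𝔼[∑_{l < T} (Ċ'_{k,l} - c) ∣ x_0 = x, a_0 = a]`. -/
def Qhat (π : Policy M nθ) (k : Fin (K + 1)) (θ : EuclideanSpace ℝ (Fin nθ)) (c : ℝ) (T : ℕ)
    (x : M.X) (a : M.A) : ℝ :=
  ∑ l ∈ Finset.range T, (π.costAt k θ x a l - c)

/-- The score `∇_θ log π_θ(a ∣ x)`, `θ ∈ Θ`. -/
def score (π : Policy M nθ) (Θ : Set (EuclideanSpace ℝ (Fin nθ))) (θ : EuclideanSpace ℝ (Fin nθ))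
    (x : M.X) (a : M.A) : EuclideanSpace ℝ (Fin nθ) :=
  gradientWithin (fun θ' => Real.log (π.dens θ' x a)) Θ θ

/-- The gradient `∇ḟ_k(θ)`, `θ ∈ Θ`. -/
def gradF (π : Policy M nθ) (Θ : Set (EuclideanSpace ℝ (Fin nθ))) (k : Fin (K + 1))
    (θ : EuclideanSpace ℝ (Fin nθ)) : EuclideanSpace ℝ (Fin nθ) :=
  gradientWithin (π.fdot k) Θ θ

/-- The family is a smooth family of probability densities over `Θ`, like a Gaussian policy on a
compact action space whose mean and variance are smooth networks: the densities are positive and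
normalized, and they are continuously differentiable in `θ`, jointly continuously in all
arguments. -/
structure IsSmooth (π : Policy M nθ) (Θ : Set (EuclideanSpace ℝ (Fin nθ))) : Prop where
  pos : ∀ θ ∈ Θ, ∀ x a, 0 < π.dens θ x a
  normalized : ∀ θ ∈ Θ, ∀ x, ∫ a, π.dens θ x a ∂π.ref = 1
  continuousOn : ContinuousOn
    (fun q : EuclideanSpace ℝ (Fin nθ) × M.X × M.A => π.dens q.1 q.2.1 q.2.2) (Θ ×ˢ univ)
  differentiableOn : ∀ x a, DifferentiableOn ℝ (fun θ => π.dens θ x a) Θ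
  continuousOn_gradient : ContinuousOn
    (fun q : EuclideanSpace ℝ (Fin nθ) × M.X × M.A =>
      gradientWithin (fun θ => π.dens θ q.2.1 q.2.2) Θ q.1) (Θ ×ˢ univ)

end Policy

/-- Total variation `∫ |α(dx) - β(dx)|`, computed with densities with respect to `α + β`. -/
def tvDist {X : Type*} [MeasurableSpace X] (α β : Measure X) : ℝ≥0∞ :=
  ∫⁻ x, ‖(α.rnDeriv (α + β) x).toReal - (β.rnDeriv (α + β) x).toReal‖ₑ ∂(α + β)

/-- The assumptions on the problem structure. -/
structure ProblemAssumptions {nS nZ nA K nθ : ℕ} (M : CMDP nS nZ nA K) (π : Policy M nθ)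
    (Θ : Set (EuclideanSpace ℝ (Fin nθ))) : Prop where
  isCompact_S : IsCompact M.S
  isCompact_Z : IsCompact M.Z
  isCompact_A : IsCompact M.A
  cost_bounded : ∃ c : ℝ, ∀ k x a x', |M.shapedCost k x a x'| ≤ c
  isCompact_Θ : IsCompact Θ
  convex_Θ : Convex ℝ Θ
  interior_Θ : (interior Θ).Nonempty
  policy_smooth : π.IsSmooth Θ
  policy_lipschitz : ∃ L : ℝ≥0, ∀ x a, LipschitzOnWith L (fun θ => π.dens θ x a) Θ
  differentiable : ∀ k, DifferentiableOn ℝ (π.fdot k) Θ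
  gradient_bounded : ∃ c : ℝ, ∀ k, ∀ θ ∈ Θ, ‖π.gradF Θ k θ‖ ≤ c
  gradient_lipschitz : ∃ L : ℝ≥0, ∀ k, LipschitzOnWith L (π.gradF Θ k) Θ
  ergodic : ∃ lam : ℝ, 0 < lam ∧ ∃ ρ : ℝ, 0 < ρ ∧ ρ < 1 ∧ ∀ θ ∈ Θ,
    ∃ d : Measure M.X, IsProbabilityMeasure d ∧ (π.chain θ).Invariant d ∧
      ∀ (x : M.X) (t : ℕ), tvDist (π.nStep θ t x) d ≤ ENNReal.ofReal (lam * ρ ^ t)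

/-- The assumptions on the step sizes `η_i` (averaging of the estimates) and `μ_i` (update of
`θ`). -/
structure StepSizeAssumptions (η μ : ℕ → ℝ) : Prop where
  antitone_μ : Antitone μ
  pos_μ : ∀ i, 0 < μ i
  le_one_μ : ∀ i, μ i ≤ 1
  tendsto_μ : Tendsto μ atTop (𝓝 0)
  sum_μ : ¬ Summable μ
  sum_sq_μ : Summable (fun i => μ i ^ 2)
  antitone_η : Antitone η
  pos_η : ∀ i, 0 < η i
  tendsto_η : Tendsto η atTop (𝓝 0)
  inv_η : ∃ ϱ : ℝ, 0 < ϱ ∧ ϱ < 1 ∧ (fun i => 1 / η i) =O[atTop] (fun i : ℕ => (i : ℝ) ^ ϱ)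
  sum_sq_η : Summable (fun i => η i ^ 2)
  tendsto_ratio : Tendsto (fun i => μ i * (η i)⁻¹) atTop (𝓝 0)

/-- The convex quadratic surrogate `f + gᵀ(θ - θ₀) + ζ ‖θ - θ₀‖²`. -/
def surrogate {n : ℕ} (f : ℝ) (g : EuclideanSpace ℝ (Fin n)) (ζ : ℝ)
    (θ₀ θ : EuclideanSpace ℝ (Fin n)) : ℝ :=
  f + inner ℝ g (θ - θ₀) + ζ * ‖θ - θ₀‖ ^ 2

/-- `θb` solves the objective update `min_{θ ∈ Θ} F_0(θ)` s.t. `F_k(θ) ≤ 0`, `k = 1, …, K`, if this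
problem is feasible, and otherwise the feasible update `min_{θ ∈ Θ, α} α` s.t. `F_k(θ) ≤ α`,
`k = 1, …, K`. -/
def IsActorSolution {n K : ℕ} (Θ : Set (EuclideanSpace ℝ (Fin n)))
    (F : Fin (K + 1) → EuclideanSpace ℝ (Fin n) → ℝ) (θb : EuclideanSpace ℝ (Fin n)) : Prop :=
  ((∃ θ ∈ Θ, ∀ k : Fin K, F k.succ θ ≤ 0) →
    θb ∈ Θ ∧ (∀ k : Fin K, F k.succ θb ≤ 0) ∧
      ∀ θ ∈ Θ, (∀ k : Fin K, F k.succ θ ≤ 0) → F 0 θb ≤ F 0 θ) ∧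
  ((¬ ∃ θ ∈ Θ, ∀ k : Fin K, F k.succ θ ≤ 0) →
    θb ∈ Θ ∧ ∃ α : ℝ, (∀ k : Fin K, F k.succ θb ≤ α) ∧
      ∀ θ ∈ Θ, ∀ α' : ℝ, (∀ k : Fin K, F k.succ θ ≤ α') → α ≤ α')

/-- A run of the algorithm on a probability space: one trajectory `x_0, a_0, x_1, a_1, …` of the
augmented CMDP, in which the actions at times `iB, …, iB + B - 1` (the `i`-th observation set) are
drawn from `π_{θ_i}`, together with the iterates and estimates computed from it. The parameters
`w i ω k` of the Q-networks may be updated in an arbitrary way. -/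
structure Run {nS nZ nA K nθ nω : ℕ} (M : CMDP nS nZ nA K) (π : Policy M nθ)
    (Θ : Set (EuclideanSpace ℝ (Fin nθ))) (B : ℕ) (η μ : ℕ → ℝ) (ζ : Fin (K + 1) → ℝ)
    (Qnet : Fin (K + 1) → EuclideanSpace ℝ (Fin nω) → M.X → M.A → ℝ)
    {Ω : Type*} [mΩ : MeasurableSpace Ω] (P : Measure Ω) where
  /-- `ℱ t` is the information available when the action at time `t` is drawn. -/
  ℱ : Filtration ℕ mΩ
  x : ℕ → Ω → M.X
  a : ℕ → Ω → M.A
  θ : ℕ → Ω → EuclideanSpace ℝ (Fin nθ)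
  θbar : ℕ → Ω → EuclideanSpace ℝ (Fin nθ)
  fhat : ℕ → Ω → Fin (K + 1) → ℝ
  ghat : ℕ → Ω → Fin (K + 1) → EuclideanSpace ℝ (Fin nθ)
  w : ℕ → Ω → Fin (K + 1) → EuclideanSpace ℝ (Fin nω)
  measurable_x : ∀ t, Measurable[ℱ t] (x t)
  measurable_a : ∀ t, Measurable[ℱ (t + 1)] (a t)
  measurable_θ : ∀ i, Measurable[ℱ (i * B)] (θ i)
  measurable_fhat_zero : Measurable[ℱ 0] (fhat 0)
  law_init : P.map (x 0) = M.init
  law_step : ∀ (t : ℕ) (U : Set (M.A × M.X)), MeasurableSet U →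
    P[((fun ω => (a t ω, x (t + 1) ω)) ⁻¹' U).indicator (fun _ => (1 : ℝ)) | ℱ t]
      =ᵐ[P] fun ω => (π.step (θ (t / B) ω) (x t ω)).real U
  /-- Averaging of the sample means of the reshaped costs. -/
  fhat_succ : ∀ i ω k, fhat (i + 1) ω k = (1 - η (i + 1)) * fhat i ω k +
    η i * ((B : ℝ)⁻¹ * ∑ j ∈ Finset.range B,
      M.shapedCost k (x (i * B + j) ω) (a (i * B + j) ω) (x (i * B + j + 1) ω))
  /-- Averaging of the sample policy gradients computed with the Q-networks. -/
  ghat_succ : ∀ i ω k, ghat (i + 1) ω k = (1 - η (i + 1)) • ghat i ω k +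
    η i • ((B : ℝ)⁻¹ • ∑ j ∈ Finset.range B,
      Qnet k (w i ω k) (x (i * B + j) ω) (a (i * B + j) ω) •
        π.score Θ (θ i ω) (x (i * B + j) ω) (a (i * B + j) ω))
  θ_zero : ∀ ω, θ 0 ω ∈ Θ
  θbar_spec : ∀ i ω, IsActorSolution Θ
    (fun k => surrogate (fhat i ω k) (ghat i ω k) (ζ k) (θ i ω)) (θbar i ω)
  θ_succ : ∀ i ω, θ (i + 1) ω = (1 - μ (i + 1)) • θ i ω + μ (i + 1) • θbar i ω

end CACRL

end

/-!
Uniform ergodicity makes the Poisson equation of the chain under `π_θ` solvable for every bounded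
function `F_θ`, with a solution `H_θ` that is uniformly continuous in `θ`. Along a run, `F` minus
its stationary mean is then a martingale difference, plus an increment of `H_{θ_t}(x_t)`, plus a
term that vanishes because the parameter moves ever more slowly. Since the steps `η_i` are
square-summable, the `η`-weighted series of the martingale differences converges almost surely, and
summation by parts takes care of the increments.

An average with steps `η_i` forgets its past, because these are not summable, and it does not notice
the drift of its target, because `μ_i / η_i → 0`. So it tracks the stationary mean of its summands.
For the costs this is `ḟ_k(θ_i)`, and for `Q_k ∇ log π` it is `∇ḟ_k(θ_i)` by the policy gradient
theorem. In the second case the error of the Q-networks enters as a bias, and any error that is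
constant in the state and the action, such as the one caused by `f̂_{k,i} ≠ ḟ_k(θ_i)` in the
truncated value functions, only multiplies scores, whose conditional means vanish.
-/

open Asymptotics

noncomputable section

namespace CACRL

/-! ### Averaging recursions -/

theorem hasSum_conditional_nat_iff {E : Type*} [AddCommMonoid E] [TopologicalSpace E]
    {u : ℕ → E} {l : E} : HasSum u l (.conditional ℕ) ↔
      Tendsto (fun n => ∑ i ∈ Finset.range n, u i) atTop (𝓝 l) := by
  simp [HasSum, Function.comp_def]

theorem summable_conditional_of_summable {E : Type*} [AddCommMonoid E] [TopologicalSpace E]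
    {u : ℕ → E} (h : Summable u) : Summable u (.conditional ℕ) :=
  ⟨_, hasSum_conditional_nat_iff.2 h.hasSum.tendsto_sum_nat⟩

theorem tendsto_zero_of_le_one_sub_mul {η c : ℕ → ℝ} (hη : ∀ n, 0 ≤ η n) (hη1 : ∀ n, η n ≤ 1)
    (hs : ¬ Summable η) (hc : ∀ n, 0 ≤ c n) (h : ∀ n, c (n + 1) ≤ (1 - η n) * c n) :
    Tendsto c atTop (𝓝 0) := by
  have hle : ∀ n, c n ≤ c 0 * Real.exp (-∑ i ∈ Finset.range n, η i) := by
    intro n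
    induction n with
    | zero => simp
    | succ n ih =>
      calc c (n + 1) ≤ (1 - η n) * c n := h n
        _ ≤ (1 - η n) * (c 0 * Real.exp (-∑ i ∈ Finset.range n, η i)) :=
          mul_le_mul_of_nonneg_left ih (sub_nonneg.2 (hη1 n))
        _ ≤ Real.exp (-η n) * (c 0 * Real.exp (-∑ i ∈ Finset.range n, η i)) :=
          mul_le_mul_of_nonneg_right (Real.one_sub_le_exp_neg _)
            (mul_nonneg (hc 0) (Real.exp_pos _).le)
        _ = c 0 * Real.exp (-∑ i ∈ Finset.range (n + 1), η i) := by
          rw [Finset.sum_range_succ, neg_add, Real.exp_add]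
          ring
  have hexp := Real.tendsto_exp_neg_atTop_nhds_zero.comp
    ((not_summable_iff_tendsto_nat_atTop_of_nonneg hη).1 hs)
  exact squeeze_zero hc hle (by simpa using hexp.const_mul (c 0))

theorem limsup_enorm_le_of_tendsto_sub_zero {E : Type*} [NormedAddCommGroup E]
    {u v : ℕ → E}
    (h : Tendsto (fun n => u n - v n) atTop (𝓝 0)) :
    limsup (fun n => ‖u n‖ₑ) atTop ≤ limsup (fun n => ‖v n‖ₑ) atTop := by
  have h0 : Tendsto (fun n => ‖u n - v n‖ₑ) atTop (𝓝 0) := by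
    simpa only [enorm_zero] using h.enorm
  rw [← ENNReal.limsup_add_of_right_tendsto_zero h0 fun n => ‖v n‖ₑ]
  refine limsup_le_limsup (.of_forall fun n => ?_)
  simpa using enorm_add_le (v n) (u n - v n)

section Averaging

variable {E : Type*} [NormedAddCommGroup E] [NormedSpace ℝ E] {η : ℕ → ℝ}

theorem tendsto_max_norm_sub_of_average {z r : ℕ → E} (hη : ∀ n, 0 ≤ η n)
    (hη0 : Tendsto η atTop (𝓝 0)) (hs : ¬ Summable η)
    (h : ∀ n, z (n + 1) = (1 - η n) • z n + η n • r n) {ε : ℝ}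
    (hr : ∀ᶠ n in atTop, ‖r n‖ ≤ ε) :
    Tendsto (fun n => max (‖z n‖ - ε) 0) atTop (𝓝 0) := by
  obtain ⟨N, hN⟩ := eventually_atTop.1 (hr.and (hη0.eventually (gt_mem_nhds one_pos)))
  refine (tendsto_add_atTop_iff_nat N).1 <| tendsto_zero_of_le_one_sub_mul
    (η := fun n => η (n + N)) (fun n => hη _) (fun n => (hN _ le_add_self).2.le)
    (by rwa [summable_nat_add_iff]) (fun n => le_max_right _ _) fun n => ?_
  obtain ⟨hrn, hηn⟩ := hN (n + N) le_add_self
  have h0 : 0 ≤ 1 - η (n + N) := by linarith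
  have hz : ‖z (n + 1 + N)‖ ≤ (1 - η (n + N)) * ‖z (n + N)‖ + η (n + N) * ε := by
    rw [add_right_comm, h]
    refine (norm_add_le _ _).trans ?_
    rw [norm_smul, norm_smul, Real.norm_of_nonneg h0, Real.norm_of_nonneg (hη _)]
    exact add_le_add_right (mul_le_mul_of_nonneg_left hrn (hη _)) _
  refine max_le ?_ (mul_nonneg h0 (le_max_right _ _))
  have := mul_le_mul_of_nonneg_left (le_max_left (‖z (n + N)‖ - ε) 0) h0
  linarith

theorem limsup_enorm_le_of_average {z r : ℕ → E} (hη : ∀ n, 0 ≤ η n)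
    (hη0 : Tendsto η atTop (𝓝 0)) (hs : ¬ Summable η)
    (h : ∀ n, z (n + 1) = (1 - η n) • z n + η n • r n) :
    limsup (fun n => ‖z n‖ₑ) atTop ≤ limsup (fun n => ‖r n‖ₑ) atTop := by
  refine le_of_forall_gt fun c hc => ?_
  obtain ⟨c₁, hrc, hc₁⟩ := exists_between hc
  obtain ⟨c₂, hc₁₂, hc₂⟩ := exists_between hc₁
  have hc₂' : c₂ ≠ ⊤ := hc₂.ne_top
  have hr : ∀ᶠ n in atTop, ‖r n‖ ≤ c₁.toReal := by
    filter_upwards [eventually_lt_of_limsup_lt hrc] with n hn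
    exact toReal_enorm (r n) ▸ ENNReal.toReal_mono hc₁.ne_top hn.le
  have hlt : c₁.toReal < c₂.toReal := (ENNReal.toReal_lt_toReal hc₁.ne_top hc₂').2 hc₁₂
  refine (limsup_le_of_le (by isBoundedDefault) (a := c₂) ?_).trans_lt hc₂
  filter_upwards [(tendsto_max_norm_sub_of_average hη hη0 hs h hr).eventually
    (gt_mem_nhds (sub_pos.2 hlt))] with n hn
  rw [← ofReal_norm, ← ENNReal.ofReal_toReal hc₂']
  exact ENNReal.ofReal_le_ofReal (by linarith [le_max_left (‖z n‖ - c₁.toReal) 0])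

/- Subtracting the tails of `∑ s` turns the perturbed recursion into an unperturbed one. -/
theorem limsup_enorm_le_of_average_add {y s r : ℕ → E} (hη : ∀ n, 0 ≤ η n)
    (hη0 : Tendsto η atTop (𝓝 0)) (hs : ¬ Summable η) (hsum : Summable s (.conditional ℕ))
    (h : ∀ n, y (n + 1) = (1 - η n) • y n + s n + η n • r n) :
    limsup (fun n => ‖y n‖ₑ) atTop ≤ limsup (fun n => ‖r n‖ₑ) atTop := by
  obtain ⟨l, hl⟩ := hsum
  set tail : ℕ → E := fun n => l - ∑ i ∈ Finset.range n, s i with htail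
  have htail0 : Tendsto tail atTop (𝓝 0) := by
    simpa using (hasSum_conditional_nat_iff.1 hl).const_sub l
  have haverage := limsup_enorm_le_of_average (z := fun n => y n + tail n)
    (r := fun n => r n + tail n) hη hη0 hs fun n => by
      simp only [h, htail, Finset.sum_range_succ]
      module
  calc limsup (fun n => ‖y n‖ₑ) atTop ≤ limsup (fun n => ‖y n + tail n‖ₑ) atTop :=
        limsup_enorm_le_of_tendsto_sub_zero (by simpa using htail0.neg)
    _ ≤ limsup (fun n => ‖r n + tail n‖ₑ) atTop := haverage
    _ ≤ limsup (fun n => ‖r n‖ₑ) atTop :=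
        limsup_enorm_le_of_tendsto_sub_zero (by simpa using htail0)

theorem summable_sub_succ (hanti : Antitone η) (hη0 : Tendsto η atTop (𝓝 0)) :
    Summable fun i => η i - η (i + 1) := by
  refine ((hasSum_iff_tendsto_nat_of_nonneg
    (fun i => sub_nonneg.2 (hanti i.le_succ)) (η 0)).2 ?_).summable
  simp_rw [Finset.sum_range_sub']
  simpa using hη0.const_sub (η 0)

variable [CompleteSpace E]

theorem summable_sub_succ_smul (hanti : Antitone η) (hη0 : Tendsto η atTop (𝓝 0))
    {v : ℕ → E} {b : ℝ} (hv : ∀ i, ‖v i‖ ≤ b) :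
    Summable fun i => (η i - η (i + 1)) • v i := by
  refine .of_norm_bounded ((summable_sub_succ hanti hη0).mul_right b) fun i => ?_
  have h0 : 0 ≤ η i - η (i + 1) := sub_nonneg.2 (hanti i.le_succ)
  rw [norm_smul, Real.norm_of_nonneg h0]
  exact mul_le_mul_of_nonneg_left (hv i) h0

theorem summable_conditional_smul_sub_succ (hanti : Antitone η) (hη0 : Tendsto η atTop (𝓝 0))
    {u : ℕ → E} {b : ℝ} (hu : ∀ i, ‖u i‖ ≤ b) :
    Summable (fun i => η i • (u i - u (i + 1))) (.conditional ℕ) := by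
  have abel : ∀ n, ∑ i ∈ Finset.range n, η i • (u i - u (i + 1)) =
      η 0 • u 0 - η n • u n - ∑ i ∈ Finset.range n, (η i - η (i + 1)) • u (i + 1) := by
    intro n
    induction n with
    | zero => simp
    | succ n ih =>
      rw [Finset.sum_range_succ, Finset.sum_range_succ, ih]
      module
  have hboundary : Tendsto (fun n => η n • u n) atTop (𝓝 0) :=
    hη0.zero_smul_isBoundedUnder_le (isBoundedUnder_of ⟨b, hu⟩)
  have hsum := summable_sub_succ_smul hanti hη0 fun i => hu (i + 1)
  exact ⟨_, hasSum_conditional_nat_iff.2 <|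
    ((hboundary.const_sub _).sub hsum.hasSum.tendsto_sum_nat).congr fun n => (abel n).symm⟩

theorem limsup_enorm_sub_le_of_tracking {est β m r : ℕ → E} {b : ℝ} (hanti : Antitone η)
    (hpos : ∀ i, 0 < η i) (hη0 : Tendsto η atTop (𝓝 0)) (hs : ¬ Summable η)
    (hm : ∀ i, ‖m i‖ ≤ b)
    (hslow : (fun i => m (i + 1) - m i) =o[atTop] fun i => η (i + 1))
    (hrec : ∀ i, est (i + 1) = (1 - η (i + 1)) • est i + η i • β i)
    (hsum : Summable (fun i => η i • (β i - m i - r i)) (.conditional ℕ)) :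
    limsup (fun i => ‖est i - m i‖ₑ) atTop ≤ limsup (fun i => ‖r i‖ₑ) atTop := by
  obtain htop | hfin := eq_or_ne (limsup (fun i => ‖r i‖ₑ) atTop) ⊤
  · simp [htop]
  obtain ⟨b', hb'⟩ : ∃ b', ∀ i, ‖r i‖ ≤ b' := by
    obtain ⟨c, hc, hc'⟩ := exists_between hfin.lt_top
    have hr : IsBoundedUnder (· ≤ ·) atTop fun i => ‖r i‖ := by
      refine isBoundedUnder_of_eventually_le (a := c.toReal) ?_
      filter_upwards [eventually_lt_of_limsup_lt hc] with i hi
      exact toReal_enorm (r i) ▸ ENNReal.toReal_mono hc'.ne hi.le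
    obtain ⟨b', hb'⟩ := hr.bddAbove_range
    exact ⟨b', fun i => hb' ⟨i, rfl⟩⟩
  set drift : ℕ → E := fun i => (η (i + 1))⁻¹ • (m (i + 1) - m i)
  have hdrift_smul (i) : η (i + 1) • drift i = m (i + 1) - m i :=
    smul_inv_smul₀ (hpos _).ne' _
  have hrw : Tendsto (fun i => r i - drift i - r i) atTop (𝓝 0) := by
    simpa using hslow.tendsto_inv_smul_nhds_zero.neg
  refine (limsup_enorm_le_of_average_add (fun i => (hpos (i + 1)).le)
    ((tendsto_add_atTop_iff_nat 1).2 hη0) (by rwa [summable_nat_add_iff])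
    (s := fun i => η i • (β i - m i - r i) + (η i - η (i + 1)) • m i + (η i - η (i + 1)) • r i)
    ((hsum.add (summable_conditional_of_summable (summable_sub_succ_smul hanti hη0 hm))).add
      (summable_conditional_of_summable (summable_sub_succ_smul hanti hη0 hb')))
    (r := fun i => r i - drift i) fun i => ?_).trans
    (limsup_enorm_le_of_tendsto_sub_zero hrw)
  rw [smul_sub (η (i + 1)), hdrift_smul, hrec]
  module

end Averaging

/-! ### Conditional laws -/

section CondLaw

variable {Ω β Γ E : Type*} {m mΩ : MeasurableSpace Ω} {P : Measure Ω} [MeasurableSpace β]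
  [MeasurableSpace Γ]

/-- Given the σ-algebra `m`, the random variable `Y` has the conditional law `κ`. This is tested on
events only, so that no regularity of the spaces is needed. -/
def IsCondLaw (P : Measure Ω) (m : MeasurableSpace Ω) (Y : Ω → β) (κ : Ω → Measure β) : Prop :=
  ∀ U, MeasurableSet U →
    P[(Y ⁻¹' U).indicator (fun _ => (1 : ℝ)) | m] =ᵐ[P] fun ω => (κ ω).real U

variable [IsFiniteMeasure P] {κ : Kernel Γ β} [IsMarkovKernel κ] {W : Ω → Γ} {Y : Ω → β}

theorem IsCondLaw.measure_preimage_inter (h : IsCondLaw P m Y fun ω => κ (W ω)) (hm : m ≤ mΩ)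
    (hW : Measurable[m] W) (hY : Measurable Y) {s : Set Ω} (hs : MeasurableSet[m] s) {U : Set β}
    (hU : MeasurableSet U) : P (Y ⁻¹' U ∩ s) = ∫⁻ ω in s, κ (W ω) U ∂P := by
  have hκ : Measurable fun ω => κ (W ω) U := (κ.measurable_coe hU).comp (hW.mono hm le_rfl)
  have hset := setIntegral_condExp (μ := P) hm (f := (Y ⁻¹' U).indicator fun _ => (1 : ℝ))
    ((integrable_const _).indicator (hY hU)) hs
  rw [setIntegral_congr_ae (hm _ hs) ((h U hU).mono fun ω hω _ => hω),
    integral_indicator (hY hU), integral_const, smul_eq_mul, mul_one,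
    measureReal_restrict_apply_univ, measureReal_restrict_apply (hY hU)] at hset
  have hfin : ∫⁻ ω in s, κ (W ω) U ∂P ≠ ⊤ := by
    refine ((lintegral_mono fun ω => prob_le_one).trans_lt ?_).ne
    rw [lintegral_one]
    exact measure_lt_top _ _
  rw [← ENNReal.toReal_eq_toReal_iff' (measure_ne_top _ _) hfin,
    ← integral_toReal hκ.aemeasurable (.of_forall fun ω => measure_lt_top _ _)]
  exact hset.symm

theorem IsCondLaw.map_prodMk_restrict (h : IsCondLaw P m Y fun ω => κ (W ω)) (hm : m ≤ mΩ)
    (hW : Measurable[m] W) (hY : Measurable Y) {s : Set Ω} (hs : MeasurableSet[m] s) :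
    (P.restrict s).map (fun ω => (W ω, Y ω)) = ((P.restrict s).map W) ⊗ₘ κ := by
  have hW' : Measurable W := hW.mono hm le_rfl
  refine Measure.ext_prod fun {A U} hA hU => ?_
  have hinter : (fun ω => (W ω, Y ω)) ⁻¹' A ×ˢ U ∩ s = Y ⁻¹' U ∩ (W ⁻¹' A ∩ s) := by
    rw [mk_preimage_prod, inter_comm (W ⁻¹' A), inter_assoc]
  rw [Measure.map_apply (hW'.prodMk hY) (hA.prod hU), Measure.compProd_apply_prod hA hU,
    Measure.restrict_apply ((hW'.prodMk hY) (hA.prod hU)), hinter,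
    h.measure_preimage_inter hm hW hY ((hW hA).inter hs) hU,
    setLIntegral_map hA (κ.measurable_coe hU) hW', Measure.restrict_restrict (hW' hA)]

theorem IsCondLaw.condExp_eq_integral [NormedAddCommGroup E] [NormedSpace ℝ E] [CompleteSpace E]
    (h : IsCondLaw P m Y fun ω => κ (W ω)) (hm : m ≤ mΩ) (hW : Measurable[m] W)
    (hY : Measurable Y) {G : Γ × β → E} (hG : StronglyMeasurable G) {b : ℝ}
    (hb : ∀ q, ‖G q‖ ≤ b) :
    P[fun ω => G (W ω, Y ω) | m] =ᵐ[P] fun ω => ∫ y, G (W ω, y) ∂κ (W ω) := by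
  have hW' : Measurable W := hW.mono hm le_rfl
  have hint : Integrable (fun ω => G (W ω, Y ω)) P :=
    .of_bound (hG.comp_measurable (hW'.prodMk hY)).aestronglyMeasurable b (.of_forall fun ω => hb _)
  have hmean : StronglyMeasurable fun w => ∫ y, G (w, y) ∂κ w := hG.integral_kernel_prod_right'
  have hmean_le (w : Γ) : ‖∫ y, G (w, y) ∂κ w‖ ≤ b := by
    simpa using norm_integral_le_of_norm_le_const (μ := κ w) (.of_forall fun y => hb (w, y))
  refine (ae_eq_condExp_of_forall_setIntegral_eq hm hint (fun s _ _ => ?_) (fun s hs _ => ?_)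
    (hmean.comp_measurable hW).aestronglyMeasurable).symm
  · exact (Integrable.of_bound (hmean.comp_measurable hW').aestronglyMeasurable b
      (.of_forall fun ω => hmean_le _)).integrableOn
  · rw [← integral_map (μ := P.restrict s) (hW'.prodMk hY).aemeasurable hG.aestronglyMeasurable,
      h.map_prodMk_restrict hm hW hY hs, Measure.integral_compProd
        (.of_bound hG.aestronglyMeasurable b (.of_forall hb)),
      integral_map hW'.aemeasurable hmean.aestronglyMeasurable]
    rfl

end CondLaw

/-! ### Series of martingale differences -/

section MartingaleDifference

variable {Ω : Type*} {mΩ : MeasurableSpace Ω} {P : Measure Ω} {ℱ : Filtration ℕ mΩ}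
  {E : Type*} [NormedAddCommGroup E] [NormedSpace ℝ E]

/-- Martingale differences `ξ t`, known at time `t + 1`, with deterministic bounds `γ t`. -/
structure IsMartingaleDifference (P : Measure Ω) (ℱ : Filtration ℕ mΩ) (ξ : ℕ → Ω → E)
    (γ : ℕ → ℝ) : Prop where
  stronglyMeasurable : ∀ t, StronglyMeasurable[ℱ (t + 1)] (ξ t)
  norm_le : ∀ t ω, ‖ξ t ω‖ ≤ γ t
  condExp_eq_zero : ∀ t, P[ξ t | ℱ t] =ᵐ[P] 0

namespace IsMartingaleDifference

section Vector

variable {ξ : ℕ → Ω → E} {γ : ℕ → ℝ}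

theorem norm_sum_le (h : IsMartingaleDifference P ℱ ξ γ) (n : ℕ) (ω : Ω) :
    ‖∑ t ∈ Finset.range n, ξ t ω‖ ≤ ∑ t ∈ Finset.range n, γ t :=
  norm_sum_le_of_le _ fun t _ => h.norm_le t ω

variable [IsFiniteMeasure P]

theorem integrable (h : IsMartingaleDifference P ℱ ξ γ) (t : ℕ) : Integrable (ξ t) P :=
  .of_bound ((h.stronglyMeasurable t).mono (ℱ.le _)).aestronglyMeasurable (γ t)
    (.of_forall (h.norm_le t))

theorem smul [CompleteSpace E] (h : IsMartingaleDifference P ℱ ξ γ) {c : ℕ → Ω → ℝ} {a : ℕ → ℝ}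
    (hc : ∀ t, StronglyMeasurable[ℱ t] (c t)) (hca : ∀ t ω, |c t ω| ≤ a t) :
    IsMartingaleDifference P ℱ (fun t ω => c t ω • ξ t ω) (fun t => a t * γ t) where
  stronglyMeasurable t := ((hc t).mono (ℱ.mono t.le_succ)).smul (h.stronglyMeasurable t)
  norm_le t ω := by
    rw [norm_smul, Real.norm_eq_abs]
    exact mul_le_mul (hca t ω) (h.norm_le t ω) (norm_nonneg _) ((abs_nonneg _).trans (hca t ω))
  condExp_eq_zero t := by
    have hint : Integrable (c t • ξ t) P := (h.integrable t).bdd_smul (a t)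
      ((hc t).mono (ℱ.le t)).aestronglyMeasurable (.of_forall (hca t))
    refine (condExp_smul_of_aestronglyMeasurable_left (hc t).aestronglyMeasurable hint
      (h.integrable t)).trans ?_
    filter_upwards [h.condExp_eq_zero t] with ω hω
    simp [hω]

theorem clm_comp [CompleteSpace E] (h : IsMartingaleDifference P ℱ ξ γ) (φ : E →L[ℝ] ℝ) :
    IsMartingaleDifference P ℱ (fun t ω => φ (ξ t ω)) (fun t => ‖φ‖ * γ t) where
  stronglyMeasurable t := φ.continuous.comp_stronglyMeasurable (h.stronglyMeasurable t)
  norm_le t ω := (φ.le_opNorm _).trans (mul_le_mul_of_nonneg_left (h.norm_le t ω) (norm_nonneg _))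
  condExp_eq_zero t := by
    refine (φ.comp_condExp_comm (h.integrable t) (m := ℱ t)).symm.trans ?_
    filter_upwards [h.condExp_eq_zero t] with ω hω
    simp [hω]

end Vector

variable [IsFiniteMeasure P] {ξ : ℕ → Ω → ℝ} {γ : ℕ → ℝ}

theorem martingale_sum (h : IsMartingaleDifference P ℱ ξ γ) :
    Martingale (fun n ω => ∑ t ∈ Finset.range n, ξ t ω) ℱ P := by
  refine martingale_of_condExp_sub_eq_zero_nat
    (fun n => Finset.stronglyMeasurable_fun_sum _ fun t ht =>
      (h.stronglyMeasurable t).mono (ℱ.mono (Finset.mem_range.1 ht)))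
    (fun n => integrable_finsetSum _ fun t _ => h.integrable t) fun n => ?_
  convert! h.condExp_eq_zero n using 2
  ext ω
  simp [Finset.sum_range_succ]

theorem integrable_sum_sq (h : IsMartingaleDifference P ℱ ξ γ) (n : ℕ) :
    Integrable (fun ω => (∑ t ∈ Finset.range n, ξ t ω) ^ 2) P := by
  refine .of_bound ((h.martingale_sum.integrable n).aestronglyMeasurable.pow 2)
    ((∑ t ∈ Finset.range n, γ t) ^ 2) (.of_forall fun ω => ?_)
  rw [norm_pow]
  exact pow_le_pow_left₀ (norm_nonneg _) (h.norm_sum_le n ω) 2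

theorem integral_sum_mul_eq_zero (h : IsMartingaleDifference P ℱ ξ γ) (n : ℕ) :
    ∫ ω, (∑ t ∈ Finset.range n, ξ t ω) * ξ n ω ∂P = 0 := by
  have hcond : P[fun ω => (∑ t ∈ Finset.range n, ξ t ω) * ξ n ω | ℱ n] =ᵐ[P] 0 := by
    refine (condExp_stronglyMeasurable_mul_of_bound (ℱ.le n)
      (h.martingale_sum.stronglyMeasurable n) (h.integrable n) _
      (.of_forall (h.norm_sum_le n))).trans ?_
    filter_upwards [h.condExp_eq_zero n] with ω hω
    simp [hω]
  rw [← integral_condExp (ℱ.le n), integral_congr_ae hcond]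
  simp

theorem integral_sum_sq_le [IsProbabilityMeasure P] (h : IsMartingaleDifference P ℱ ξ γ) (n : ℕ) :
    ∫ ω, (∑ t ∈ Finset.range n, ξ t ω) ^ 2 ∂P ≤ ∑ t ∈ Finset.range n, γ t ^ 2 := by
  induction n with
  | zero => simp
  | succ n ih =>
    set S : Ω → ℝ := fun ω => ∑ t ∈ Finset.range n, ξ t ω with hS
    have hle (ω : Ω) : ‖ξ n ω ^ 2‖ ≤ γ n ^ 2 := by
      rw [norm_pow]
      exact pow_le_pow_left₀ (norm_nonneg _) (h.norm_le n ω) 2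
    have hξ : Integrable (fun ω => ξ n ω ^ 2) P :=
      .of_bound ((h.integrable n).aestronglyMeasurable.pow 2) (γ n ^ 2) (.of_forall hle)
    have hSξ : Integrable (fun ω => 2 * (S ω * ξ n ω)) P :=
      ((h.integrable n).bdd_mul (h.martingale_sum.integrable n).aestronglyMeasurable
        (.of_forall (h.norm_sum_le n))).const_mul 2
    have hξγ : ∫ ω, ξ n ω ^ 2 ∂P ≤ γ n ^ 2 := by
      simpa using integral_mono hξ (integrable_const (μ := P) _) fun ω =>
        (le_abs_self _).trans (hle ω)
    calc ∫ ω, (∑ t ∈ Finset.range (n + 1), ξ t ω) ^ 2 ∂P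
        = ∫ ω, (S ω ^ 2 + 2 * (S ω * ξ n ω) + ξ n ω ^ 2) ∂P := by
          refine integral_congr_ae (.of_forall fun ω => ?_)
          simp only [hS, Finset.sum_range_succ]
          ring
      _ = ∫ ω, S ω ^ 2 ∂P + ∫ ω, ξ n ω ^ 2 ∂P := by
          rw [integral_add (f := fun ω => S ω ^ 2 + 2 * (S ω * ξ n ω))
              ((h.integrable_sum_sq n).add hSξ) hξ,
            integral_add (h.integrable_sum_sq n) hSξ, integral_const_mul,
            h.integral_sum_mul_eq_zero n, mul_zero, add_zero]
      _ ≤ ∑ t ∈ Finset.range (n + 1), γ t ^ 2 := by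
          rw [Finset.sum_range_succ]
          exact add_le_add ih hξγ

variable [IsProbabilityMeasure P]

theorem ae_summable_real (h : IsMartingaleDifference P ℱ ξ γ) (hγ : Summable fun t => γ t ^ 2) :
    ∀ᵐ ω ∂P, Summable (fun t => ξ t ω) (.conditional ℕ) := by
  have hbdd (n : ℕ) : eLpNorm (fun ω => ∑ t ∈ Finset.range n, ξ t ω) 1 P ≤
      ((1 + ∑' t, γ t ^ 2).toNNReal : ℝ≥0∞) := by
    have hint := h.martingale_sum.integrable n
    rw [eLpNorm_one_eq_lintegral_enorm, ← ofReal_integral_norm_eq_lintegral_enorm hint]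
    refine ENNReal.ofReal_le_ofReal ?_
    calc ∫ ω, ‖∑ t ∈ Finset.range n, ξ t ω‖ ∂P
        ≤ ∫ ω, (1 + (∑ t ∈ Finset.range n, ξ t ω) ^ 2) ∂P := by
          refine integral_mono hint.norm ((integrable_const _).add (h.integrable_sum_sq n))
            fun ω => ?_
          rw [Real.norm_eq_abs, ← sq_abs]
          nlinarith [sq_nonneg (|∑ t ∈ Finset.range n, ξ t ω| - 1)]
      _ = 1 + ∫ ω, (∑ t ∈ Finset.range n, ξ t ω) ^ 2 ∂P := by
          rw [integral_add (integrable_const _) (h.integrable_sum_sq n)]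
          simp
      _ ≤ 1 + ∑' t, γ t ^ 2 := by
          gcongr
          exact (h.integral_sum_sq_le n).trans (hγ.sum_le_tsum _ fun t _ => sq_nonneg _)
  filter_upwards [h.martingale_sum.submartingale.exists_ae_tendsto_of_bdd hbdd] with ω ⟨l, hl⟩
  exact ⟨l, hasSum_conditional_nat_iff.2 hl⟩

theorem ae_summable [FiniteDimensional ℝ E] {ξ : ℕ → Ω → E} (h : IsMartingaleDifference P ℱ ξ γ)
    (hγ : Summable fun t => γ t ^ 2) :
    ∀ᵐ ω ∂P, Summable (fun t => ξ t ω) (.conditional ℕ) := by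
  have : CompleteSpace E := FiniteDimensional.complete ℝ E
  set e := (Module.finBasis ℝ E).equivFunL
  have hcoord (j) : ∀ᵐ ω ∂P, Summable (fun t => e (ξ t ω) j) (.conditional ℕ) :=
    (h.clm_comp ((ContinuousLinearMap.proj j).comp e.toContinuousLinearMap)).ae_summable_real
      (by simpa only [mul_pow] using hγ.mul_left _)
  filter_upwards [ae_all_iff.2 hcoord] with ω hω
  have he : Summable (fun t => e (ξ t ω)) (.conditional ℕ) := Pi.summable.2 hω
  simpa [Function.comp_def] using he.map e.symm e.symm.continuous

end IsMartingaleDifference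

end MartingaleDifference

/-! ### Regular families of functions -/

section Regular

variable {T X Y E E' : Type*} [PseudoMetricSpace T] [MeasurableSpace T] [MeasurableSpace X]
  [MeasurableSpace Y] [NormedAddCommGroup E] [NormedAddCommGroup E']

/-- A family of functions of `x` that depends regularly on a parameter `θ`: it is jointly
measurable, bounded, and uniformly continuous in `θ` uniformly in `x`. No continuity in `x` is
asked for, since the kernels of a decision process need not preserve it. -/
structure IsRegular (F : T → X → E) : Prop where
  stronglyMeasurable : StronglyMeasurable (Function.uncurry F)
  exists_norm_le : ∃ b, ∀ θ x, ‖F θ x‖ ≤ b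
  uniformEquicontinuous : UniformEquicontinuous fun x θ => F θ x

namespace IsRegular

theorem apply {F : T → X → E} (hF : IsRegular F) (θ : T) : StronglyMeasurable (F θ) :=
  hF.stronglyMeasurable.comp_measurable measurable_prodMk_left

theorem integrable {F : T → X → E} (hF : IsRegular F) (θ : T) (ν : Measure X) [IsFiniteMeasure ν] :
    Integrable (F θ) ν :=
  have ⟨b, hb⟩ := hF.exists_norm_le
  .of_bound (hF.apply θ).aestronglyMeasurable b (.of_forall (hb θ))

theorem const {f : X → E} (hf : StronglyMeasurable f) {b : ℝ} (hb : ∀ x, ‖f x‖ ≤ b) :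
    IsRegular fun (_ : T) x => f x where
  stronglyMeasurable := hf.comp_measurable measurable_snd
  exists_norm_le := ⟨b, fun _ => hb⟩
  uniformEquicontinuous := Metric.uniformEquicontinuous_iff.2 fun ε hε =>
    ⟨1, one_pos, fun θ θ' _ x => by rwa [dist_self]⟩

theorem freeze {F : T → X → E} (hF : IsRegular F) (θ₀ : T) : IsRegular fun (_ : T) x => F θ₀ x :=
  have ⟨_, hb⟩ := hF.exists_norm_le
  .const (hF.apply θ₀) (hb θ₀)

theorem comp_measurable {F : T → X → E} (hF : IsRegular F) {g : Y → X} (hg : Measurable g) :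
    IsRegular fun θ y => F θ (g y) where
  stronglyMeasurable := hF.stronglyMeasurable.comp_measurable
    (measurable_fst.prodMk (hg.comp measurable_snd))
  exists_norm_le := hF.exists_norm_le.imp fun _ hb θ y => hb θ (g y)
  uniformEquicontinuous := hF.uniformEquicontinuous.comp g

theorem tendsto_sub {F : T → X → E} (hF : IsRegular F) {θ θ' : ℕ → T}
    (hθ : Tendsto (fun t => dist (θ t) (θ' t)) atTop (𝓝 0)) (x : ℕ → X) :
    Tendsto (fun t => F (θ t) (x t) - F (θ' t) (x t)) atTop (𝓝 0) := by
  refine NormedAddGroup.tendsto_nhds_zero.2 fun ε hε => ?_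
  obtain ⟨δ, hδ, hFδ⟩ := Metric.uniformEquicontinuous_iff.1 hF.uniformEquicontinuous ε hε
  filter_upwards [hθ.eventually (gt_mem_nhds hδ)] with t ht
  rw [← dist_eq_norm]
  exact hFδ _ _ ht _

theorem prodMk {F : T → X → E} {G : T → X → E'} (hF : IsRegular F) (hG : IsRegular G) :
    IsRegular fun θ x => (F θ x, G θ x) where
  stronglyMeasurable := hF.stronglyMeasurable.prodMk hG.stronglyMeasurable
  exists_norm_le := by
    obtain ⟨b, hb⟩ := hF.exists_norm_le
    obtain ⟨b', hb'⟩ := hG.exists_norm_le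
    exact ⟨max b b', fun θ x => max_le_max (hb θ x) (hb' θ x)⟩
  uniformEquicontinuous := by
    refine Metric.uniformEquicontinuous_iff.2 fun ε hε => ?_
    obtain ⟨δ, hδ, hFδ⟩ := Metric.uniformEquicontinuous_iff.1 hF.uniformEquicontinuous ε hε
    obtain ⟨δ', hδ', hGδ⟩ := Metric.uniformEquicontinuous_iff.1 hG.uniformEquicontinuous ε hε
    exact ⟨min δ δ', lt_min hδ hδ', fun θ θ' h x => max_lt
      (hFδ θ θ' (h.trans_le (min_le_left _ _)) x) (hGδ θ θ' (h.trans_le (min_le_right _ _)) x)⟩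

theorem comp_continuous [ProperSpace E] {F : T → X → E} (hF : IsRegular F) {φ : E → E'}
    (hφ : Continuous φ) : IsRegular fun θ x => φ (F θ x) := by
  obtain ⟨b, hb⟩ := hF.exists_norm_le
  have hmem (θ x) : F θ x ∈ Metric.closedBall 0 b := mem_closedBall_zero_iff.2 (hb θ x)
  have hball : IsCompact (Metric.closedBall (0 : E) b) := isCompact_closedBall _ _
  obtain ⟨b', hb'⟩ := hball.exists_bound_of_continuousOn hφ.continuousOn
  refine ⟨hφ.comp_stronglyMeasurable hF.stronglyMeasurable, ⟨b', fun θ x => hb' _ (hmem θ x)⟩,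
    Metric.uniformEquicontinuous_iff.2 fun ε hε => ?_⟩
  obtain ⟨δ, hδ, hφδ⟩ := Metric.uniformContinuousOn_iff.1
    (hball.uniformContinuousOn_of_continuous hφ.continuousOn) ε hε
  obtain ⟨δ', hδ', hFδ⟩ := Metric.uniformEquicontinuous_iff.1 hF.uniformEquicontinuous δ hδ
  exact ⟨δ', hδ', fun θ θ' h x => hφδ _ (hmem θ x) _ (hmem θ' x) (hFδ θ θ' h x)⟩

theorem of_tendstoUniformly {F : ℕ → T → X → E} {G : T → X → E} (hF : ∀ n, IsRegular (F n))
    (h : TendstoUniformly (fun n => Function.uncurry (F n)) (Function.uncurry G) atTop) :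
    IsRegular G where
  stronglyMeasurable := stronglyMeasurable_of_tendsto atTop (fun n => (hF n).stronglyMeasurable)
    (tendsto_pi_nhds.2 h.tendsto_at)
  exists_norm_le := by
    obtain ⟨n, hn⟩ := (Metric.tendstoUniformly_iff.1 h 1 one_pos).exists
    obtain ⟨b, hb⟩ := (hF n).exists_norm_le
    exact ⟨1 + b, fun θ x => (norm_le_norm_sub_add _ (F n θ x)).trans
      (add_le_add (dist_eq_norm (G θ x) _ ▸ (hn (θ, x)).le) (hb θ x))⟩
  uniformEquicontinuous := by
    refine Metric.uniformEquicontinuous_iff.2 fun ε hε => ?_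
    obtain ⟨n, hn⟩ := (Metric.tendstoUniformly_iff.1 h (ε / 3) (by positivity)).exists
    obtain ⟨δ, hδ, hFδ⟩ := Metric.uniformEquicontinuous_iff.1 (hF n).uniformEquicontinuous
      (ε / 3) (by positivity)
    refine ⟨δ, hδ, fun θ θ' hθ x => ?_⟩
    calc dist (G θ x) (G θ' x)
        ≤ dist (G θ x) (F n θ x) + dist (F n θ x) (F n θ' x) + dist (F n θ' x) (G θ' x) :=
          dist_triangle4 _ _ _ _
      _ < ε / 3 + ε / 3 + ε / 3 :=
          add_lt_add (add_lt_add (hn (θ, x)) (hFδ θ θ' hθ x)) (dist_comm (F n θ' x) _ ▸ hn (θ', x))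
      _ = ε := by ring

theorem integral_kernel [NormedSpace ℝ E] {F : T → Y × X → E} (hF : IsRegular F)
    (κ : Kernel Y X) [IsFiniteKernel κ] : IsRegular fun θ y => ∫ x, F θ (y, x) ∂κ y := by
  obtain ⟨b, hb⟩ := hF.exists_norm_le
  have hint (θ y) : Integrable (fun x => F θ (y, x)) (κ y) :=
    .of_bound ((hF.apply θ).comp_measurable measurable_prodMk_left).aestronglyMeasurable b
      (.of_forall fun x => hb θ (y, x))
  have hnorm {y : Y} {f : X → E} {c : ℝ} (hc : 0 ≤ c) (hf : ∀ x, ‖f x‖ ≤ c) :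
      ‖∫ x, f x ∂κ y‖ ≤ c * κ.bound.toReal :=
    (norm_integral_le_of_norm_le_const (.of_forall hf)).trans (mul_le_mul_of_nonneg_left
      (ENNReal.toReal_mono κ.bound_ne_top (κ.measure_le_bound y _)) hc)
  refine ⟨?_, ⟨|b| * κ.bound.toReal, fun θ y => hnorm (abs_nonneg b) fun x =>
    (hb θ (y, x)).trans (le_abs_self b)⟩, Metric.uniformEquicontinuous_iff.2 fun ε hε => ?_⟩
  · exact StronglyMeasurable.integral_kernel_prod_right (κ := κ.comap Prod.snd measurable_snd)
      (f := fun (q : T × Y) x => F q.1 (q.2, x))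
      (hF.stronglyMeasurable.comp_measurable
        (g := fun q : (T × Y) × X => (q.1.1, q.1.2, q.2)) (by fun_prop))
  · obtain ⟨δ, hδ, hFδ⟩ := Metric.uniformEquicontinuous_iff.1 hF.uniformEquicontinuous
      (ε / (κ.bound.toReal + 1)) (by positivity)
    refine ⟨δ, hδ, fun θ θ' hθ y => ?_⟩
    rw [dist_eq_norm, ← integral_sub (hint θ y) (hint θ' y)]
    refine (hnorm (c := ε / (κ.bound.toReal + 1)) (by positivity) fun x =>
      dist_eq_norm (F θ (y, x)) _ ▸ (hFδ θ θ' hθ (y, x)).le).trans_lt ?_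
    rw [div_mul_eq_mul_div, div_lt_iff₀ (by positivity)]
    exact mul_lt_mul_of_pos_left (lt_add_one _) hε

theorem of_continuous {T X : Type*} [PseudoMetricSpace T] [CompactSpace T] [PseudoMetricSpace X]
    [CompactSpace X] [MeasurableSpace T] [MeasurableSpace X] [OpensMeasurableSpace (T × X)]
    [SecondCountableTopologyEither (T × X) E] {F : T → X → E}
    (hF : Continuous (Function.uncurry F)) : IsRegular F where
  stronglyMeasurable := hF.stronglyMeasurable
  exists_norm_le :=
    have ⟨b, hb⟩ := isCompact_univ.exists_bound_of_continuousOn hF.continuousOn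
    ⟨b, fun θ x => hb (θ, x) (mem_univ _)⟩
  uniformEquicontinuous := by
    refine Metric.uniformEquicontinuous_iff.2 fun ε hε => ?_
    obtain ⟨δ, hδ, hFδ⟩ := Metric.uniformContinuous_iff.1
      (CompactSpace.uniformContinuous_of_continuous hF) ε hε
    exact ⟨δ, hδ, fun θ θ' hθ x => hFδ (a := (θ, x)) (b := (θ', x)) (by simpa [Prod.dist_eq])⟩

section Algebra

variable [ProperSpace E] {F G : T → X → E}

theorem add (hF : IsRegular F) (hG : IsRegular G) : IsRegular fun θ x => F θ x + G θ x :=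
  (hF.prodMk hG).comp_continuous continuous_add

theorem sub (hF : IsRegular F) (hG : IsRegular G) : IsRegular fun θ x => F θ x - G θ x :=
  (hF.prodMk hG).comp_continuous continuous_sub

theorem smul [NormedSpace ℝ E] {f : T → X → ℝ} (hf : IsRegular f) (hF : IsRegular F) :
    IsRegular fun θ x => f θ x • F θ x :=
  (hf.prodMk hF).comp_continuous continuous_smul

theorem sum {F : ℕ → T → X → E} (hF : ∀ t, IsRegular (F t)) (n : ℕ) :
    IsRegular fun θ x => ∑ t ∈ Finset.range n, F t θ x := by
  induction n with
  | zero => exact const (f := 0) stronglyMeasurable_zero fun _ => norm_zero.le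
  | succ n ih => simpa only [Finset.sum_range_succ] using ih.add (hF n)

end Algebra

end IsRegular

end Regular

/-! ### Ergodic families of kernels and the Poisson equation -/

theorem norm_integral_sub_integral_le_tvDist {X E : Type*} [MeasurableSpace X]
    [NormedAddCommGroup E] [NormedSpace ℝ E] {α β : Measure X} [IsFiniteMeasure α]
    [IsFiniteMeasure β] {f : X → E} (hf : StronglyMeasurable f) {b : ℝ} (hb : ∀ x, ‖f x‖ ≤ b)
    (hb₀ : 0 ≤ b) {τ : ℝ≥0} (h : tvDist α β ≤ τ) :
    ‖∫ x, f x ∂α - ∫ x, f x ∂β‖ ≤ b * τ := by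
  set φ : X → ℝ := fun x => (α.rnDeriv (α + β) x).toReal - (β.rnDeriv (α + β) x).toReal with hφ
  have hα : α ≪ α + β := Measure.AbsolutelyContinuous.rfl.add_right β
  have hβ : β ≪ α + β := Measure.AbsolutelyContinuous.rfl.add_right' α
  have hfα : Integrable f α := .of_bound hf.aestronglyMeasurable b (.of_forall hb)
  have hfβ : Integrable f β := .of_bound hf.aestronglyMeasurable b (.of_forall hb)
  have hint : Integrable φ (α + β) :=
    Measure.integrable_toReal_rnDeriv.sub Measure.integrable_toReal_rnDeriv
  calc ‖∫ x, f x ∂α - ∫ x, f x ∂β‖ = ‖∫ x, φ x • f x ∂(α + β)‖ := by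
        rw [← integral_rnDeriv_smul hα, ← integral_rnDeriv_smul hβ, ← integral_sub
          ((integrable_rnDeriv_smul_iff hα).2 hfα) ((integrable_rnDeriv_smul_iff hβ).2 hfβ)]
        simp only [hφ, sub_smul]
    _ ≤ ∫ x, b * ‖φ x‖ ∂(α + β) := by
        refine norm_integral_le_of_norm_le (hint.norm.const_mul b) (.of_forall fun x => ?_)
        rw [norm_smul, mul_comm]
        exact mul_le_mul_of_nonneg_right (hb x) (norm_nonneg _)
    _ ≤ b * τ := by
        rw [integral_const_mul]
        refine mul_le_mul_of_nonneg_left ?_ hb₀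
        rw [← ENNReal.ofReal_le_ofReal_iff τ.coe_nonneg,
          ofReal_integral_norm_eq_lintegral_enorm hint, ENNReal.ofReal_coe_nnreal]
        exact h

section Ergodic

variable {T X Y E : Type*} [PseudoMetricSpace T] [MeasurableSpace T] [MeasurableSpace X]
  [MeasurableSpace Y] [NormedAddCommGroup E] [NormedSpace ℝ E]

/-- The conditional mean `∫ G_θ(x, y) κ_θ(x, dy)` of a family of functions given `x`. -/
def conditionalMean (κ : Kernel (T × X) Y) (G : T → X × Y → E) : T → X → E :=
  fun θ x => ∫ y, G θ (x, y) ∂κ (θ, x)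

/-- The action `(κ F)_θ(x) = ∫ F_θ(y) κ_θ(x, dy)` of a family of kernels on a family of
functions. -/
def push (κ : Kernel (T × X) Y) (F : T → Y → E) : T → X → E :=
  fun θ x => ∫ y, F θ y ∂κ (θ, x)

/-- A regular family of kernels: `E`-valued conditional means of regular families are regular. -/
def IsRegularKernel (E : Type*) [NormedAddCommGroup E] [NormedSpace ℝ E]
    (κ : Kernel (T × X) Y) : Prop :=
  ∀ G : T → X × Y → E, IsRegular G → IsRegular (conditionalMean κ G)

theorem IsRegularKernel.push {κ : Kernel (T × X) Y} (hκ : IsRegularKernel E κ) {F : T → Y → E}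
    (hF : IsRegular F) : IsRegular (push κ F) :=
  hκ (fun θ q => F θ q.2) (hF.comp_measurable measurable_snd)

theorem IsRegularKernel.snd {A : Type*} [MeasurableSpace A] {κ : Kernel (T × X) (A × Y)}
    (hκ : IsRegularKernel E κ) : IsRegularKernel E κ.snd := by
  intro G hG
  have hmean : conditionalMean κ.snd G = conditionalMean κ fun θ q => G θ (q.1, q.2.2) := by
    ext θ x
    exact (congrArg (∫ y, G θ (x, y) ∂·) (Kernel.snd_apply κ (θ, x))).trans <|
      integral_map (f := fun y => G θ (x, y)) measurable_snd.aemeasurable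
        ((hG.apply θ).comp_measurable measurable_prodMk_left).aestronglyMeasurable
  exact hmean ▸ hκ _ (hG.comp_measurable (by fun_prop))

/-- A family of Markov kernels `κ (θ, ·)` with stationary laws `d θ`, to which the iterated kernels
converge in total variation at a summable rate, uniformly in `θ` and in the initial point. -/
structure IsErgodicFamily (κ : Kernel (T × X) X) (d : T → Measure X) : Prop where
  isProbabilityMeasure : ∀ θ, IsProbabilityMeasure (d θ)
  invariant : ∀ θ, (κ.sectR θ).Invariant (d θ)
  exists_tvDist_le : ∃ r : ℕ → ℝ≥0, Summable r ∧
    ∀ t θ x, tvDist ((κ.sectR θ ^ t) x) (d θ) ≤ r t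

variable {κ : Kernel (T × X) X} {d : T → Measure X} {F : T → X → E}

theorem IsRegularKernel.push_iterate (hκ : IsRegularKernel E κ) (hF : IsRegular F) (t : ℕ) :
    IsRegular ((CACRL.push κ)^[t] F) := by
  induction t with
  | zero => exact hF
  | succ t ih => rw [Function.iterate_succ_apply']; exact hκ.push ih

variable [IsMarkovKernel κ]

instance isMarkovKernel_pow (κ : Kernel X X) [IsMarkovKernel κ] (t : ℕ) :
    IsMarkovKernel (κ ^ t) := by
  induction t with
  | zero => exact inferInstanceAs (IsMarkovKernel Kernel.id)
  | succ t ih => rw [pow_succ']; exact inferInstanceAs (IsMarkovKernel (κ ∘ₖ (κ ^ t)))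

theorem push_iterate_eq_integral [CompleteSpace E] (hκ : IsRegularKernel E κ) (hF : IsRegular F)
    (t : ℕ) (θ : T) (x : X) : (push κ)^[t] F θ x = ∫ y, F θ y ∂(κ.sectR θ ^ t) x := by
  induction t generalizing F with
  | zero => exact (integral_dirac' _ _ (hF.apply θ)).symm
  | succ t ih =>
    rw [Function.iterate_succ_apply, ih (hκ.push hF), add_comm, Kernel.pow_add, pow_one,
      Kernel.integral_comp (hF.integrable θ _)]
    rfl

namespace IsErgodicFamily

variable (h : IsErgodicFamily κ d)
include h

theorem integral_push (hF : IsRegular F) (θ : T) : ∫ x, push κ F θ x ∂d θ = ∫ x, F θ x ∂d θ := by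
  have := h.isProbabilityMeasure θ
  obtain ⟨x⟩ := nonempty_of_isProbabilityMeasure (d θ)
  have hd : (κ.sectR θ ∘ₖ Kernel.const X (d θ)) x = d θ := by
    rw [(h.invariant θ).comp_const, Kernel.const_apply]
  conv_rhs => rw [← hd]
  rw [Kernel.integral_comp (hF.integrable θ _), Kernel.const_apply]
  rfl

variable [ProperSpace E] (hκ : IsRegularKernel E κ) (hF : IsRegular F)
include hκ hF

theorem exists_norm_push_iterate_sub_le : ∃ s : ℕ → ℝ, Summable s ∧
    ∀ t θ x, ‖(push κ)^[t] F θ x - ∫ y, F θ y ∂d θ‖ ≤ s t := by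
  obtain ⟨r, hr, htv⟩ := h.exists_tvDist_le
  obtain ⟨b, hb⟩ := hF.exists_norm_le
  refine ⟨fun t => |b| * r t, (NNReal.summable_coe.2 hr).mul_left _, fun t θ x => ?_⟩
  have := h.isProbabilityMeasure θ
  rw [push_iterate_eq_integral hκ hF]
  exact norm_integral_sub_integral_le_tvDist (hF.apply θ)
    (fun x => (hb θ x).trans (le_abs_self b)) (abs_nonneg b) (htv t θ x)

theorem isRegular_integral : IsRegular fun θ (_ : X) => ∫ y, F θ y ∂d θ := by
  obtain ⟨s, hs, hle⟩ := h.exists_norm_push_iterate_sub_le hκ hF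
  refine .of_tendstoUniformly (fun t => hκ.push_iterate hF t) <|
    (Metric.tendstoUniformly_iff.2 fun ε hε => ?_)
  filter_upwards [hs.tendsto_atTop_zero.eventually (gt_mem_nhds hε)] with t ht q
  rw [dist_comm, dist_eq_norm]
  exact (hle t q.1 q.2).trans_lt ht

end IsErgodicFamily

/-- The solution `∑ₜ (κᵗ F - ∫ F ∂d)` of the Poisson equation of an ergodic family. -/
def poisson (κ : Kernel (T × X) X) (d : T → Measure X) (F : T → X → E) : T → X → E :=
  fun θ x => ∑' t, ((push κ)^[t] F θ x - ∫ y, F θ y ∂d θ)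

namespace IsErgodicFamily

variable [ProperSpace E] (h : IsErgodicFamily κ d) (hκ : IsRegularKernel E κ) (hF : IsRegular F)
include h hκ hF

theorem isRegular_poisson : IsRegular (poisson κ d F) := by
  obtain ⟨s, hs, hle⟩ := h.exists_norm_push_iterate_sub_le hκ hF
  exact .of_tendstoUniformly
    (IsRegular.sum fun t => (hκ.push_iterate hF t).sub (h.isRegular_integral hκ hF))
    (tendstoUniformly_tsum_nat hs fun t (q : T × X) => hle t q.1 q.2)

theorem hasSum_integral_poisson (θ : T) (ν : Measure X) [IsProbabilityMeasure ν] :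
    HasSum (fun t => ∫ y, (push κ)^[t] F θ y ∂ν - ∫ y, F θ y ∂d θ)
      (∫ y, poisson κ d F θ y ∂ν) := by
  obtain ⟨s, hs, hle⟩ := h.exists_norm_push_iterate_sub_le hκ hF
  have hint (t : ℕ) : Integrable (fun y => (push κ)^[t] F θ y - ∫ y, F θ y ∂d θ) ν :=
    ((hκ.push_iterate hF t).integrable θ _).sub (integrable_const _)
  refine (hasSum_integral_of_summable_integral_norm hint (.of_nonneg_of_le
    (fun t => integral_nonneg fun y => norm_nonneg _) (fun t => ?_) hs)).congr_fun ?_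
  · simpa using integral_mono (hint t).norm (integrable_const (s t)) fun y => hle t θ y
  · intro t
    rw [integral_sub ((hκ.push_iterate hF t).integrable θ _) (integrable_const _)]
    simp

theorem poisson_sub_push_poisson (θ : T) (x : X) :
    poisson κ d F θ x - push κ (poisson κ d F) θ x = F θ x - ∫ y, F θ y ∂d θ := by
  obtain ⟨s, hs, hle⟩ := h.exists_norm_push_iterate_sub_le hκ hF
  have hsum : Summable fun t => (push κ)^[t] F θ x - ∫ y, F θ y ∂d θ :=
    .of_norm_bounded hs fun t => hle t θ x
  have hpush : push κ (poisson κ d F) θ x =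
      ∑' t, ((push κ)^[t + 1] F θ x - ∫ y, F θ y ∂d θ) := by
    rw [push, ← (h.hasSum_integral_poisson hκ hF θ (κ (θ, x))).tsum_eq]
    simp only [Function.iterate_succ_apply']
    rfl
  rw [hpush, poisson, hsum.tsum_eq_zero_add, add_sub_cancel_right]
  rfl

end IsErgodicFamily

end Ergodic

/-! ### Averages along a controlled Markov chain -/

section ControlledChain

variable {Ω T X A E : Type*} {mΩ : MeasurableSpace Ω} {P : Measure Ω} {ℱ : Filtration ℕ mΩ}
  [MeasurableSpace T] [MeasurableSpace X] [MeasurableSpace A] [NormedAddCommGroup E]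
  [NormedSpace ℝ E]

/-- A Markov chain `x` with actions `a` and an adapted control parameter `θ`: given the past, the
law of `(a t, x (t + 1))` is `κ (θ t, x t)`. -/
structure IsControlledChain (P : Measure Ω) (ℱ : Filtration ℕ mΩ) (κ : Kernel (T × X) (A × X))
    (θ : ℕ → Ω → T) (x : ℕ → Ω → X) (a : ℕ → Ω → A) : Prop where
  measurable_θ : ∀ t, Measurable[ℱ t] (θ t)
  measurable_x : ∀ t, Measurable[ℱ t] (x t)
  measurable_a : ∀ t, Measurable[ℱ (t + 1)] (a t)
  isCondLaw : ∀ t, IsCondLaw P (ℱ t) (fun ω => (a t ω, x (t + 1) ω)) fun ω => κ (θ t ω, x t ω)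

namespace IsControlledChain

variable {κ : Kernel (T × X) (A × X)} [IsMarkovKernel κ] {θ : ℕ → Ω → T} {x : ℕ → Ω → X}
  {a : ℕ → Ω → A} [IsProbabilityMeasure P] (h : IsControlledChain P ℱ κ θ x a)
include h

theorem isMartingaleDifference_noise [CompleteSpace E] {G : (T × X) × A × X → E}
    (hG : StronglyMeasurable G) {b : ℝ} (hb : ∀ q, ‖G q‖ ≤ b) :
    IsMartingaleDifference P ℱ (fun t ω => G ((θ t ω, x t ω), a t ω, x (t + 1) ω) -
      ∫ p, G ((θ t ω, x t ω), p) ∂κ (θ t ω, x t ω)) fun _ => b + b := by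
  have hW (t : ℕ) : Measurable[ℱ t] fun ω => (θ t ω, x t ω) :=
    (h.measurable_θ t).prodMk (h.measurable_x t)
  have hY (t : ℕ) : Measurable[ℱ (t + 1)] fun ω => (a t ω, x (t + 1) ω) :=
    (h.measurable_a t).prodMk (h.measurable_x (t + 1))
  have hWY (t : ℕ) : Measurable[ℱ (t + 1)] fun ω => ((θ t ω, x t ω), a t ω, x (t + 1) ω) :=
    ((hW t).mono (ℱ.mono t.le_succ) le_rfl).prodMk (hY t)
  have hmean : StronglyMeasurable fun w => ∫ p, G (w, p) ∂κ w := hG.integral_kernel_prod_right'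
  have hmean_le (w : T × X) : ‖∫ p, G (w, p) ∂κ w‖ ≤ b := by
    simpa using norm_integral_le_of_norm_le_const (μ := κ w) (.of_forall fun p => hb (w, p))
  have hmeanW (t : ℕ) : StronglyMeasurable[ℱ t] fun ω =>
      ∫ p, G ((θ t ω, x t ω), p) ∂κ (θ t ω, x t ω) := hmean.comp_measurable (hW t)
  refine ⟨fun t => (hG.comp_measurable (hWY t)).sub ((hmeanW t).mono (ℱ.mono t.le_succ)),
    fun t ω => (norm_sub_le _ _).trans (add_le_add (hb _) (hmean_le _)), fun t => ?_⟩
  have hint : Integrable (fun ω => G ((θ t ω, x t ω), a t ω, x (t + 1) ω)) P :=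
    .of_bound ((hG.comp_measurable (hWY t)).mono (ℱ.le _)).aestronglyMeasurable b
      (.of_forall fun ω => hb _)
  have hintW : Integrable (fun ω => ∫ p, G ((θ t ω, x t ω), p) ∂κ (θ t ω, x t ω)) P :=
    .of_bound ((hmeanW t).mono (ℱ.le t)).aestronglyMeasurable b (.of_forall fun ω => hmean_le _)
  refine (condExp_sub hint hintW (ℱ t)).trans ?_
  rw [condExp_of_stronglyMeasurable (ℱ.le t) (hmeanW t) hintW]
  filter_upwards [(h.isCondLaw t).condExp_eq_integral (ℱ.le t) (hW t)
    ((hY t).mono (ℱ.le _) le_rfl) hG hb] with ω hω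
  simp [hω]

theorem ae_summable_smul_noise [FiniteDimensional ℝ E] {G : (T × X) × A × X → E}
    (hG : StronglyMeasurable G) {b : ℝ} (hb : ∀ q, ‖G q‖ ≤ b) {c : ℕ → Ω → ℝ}
    (hc : ∀ t, StronglyMeasurable[ℱ t] (c t)) {α : ℕ → ℝ} (hcα : ∀ t ω, |c t ω| ≤ α t)
    (hα : Summable fun t => α t ^ 2) :
    ∀ᵐ ω ∂P, Summable (fun t => c t ω • (G ((θ t ω, x t ω), a t ω, x (t + 1) ω) -
      ∫ p, G ((θ t ω, x t ω), p) ∂κ (θ t ω, x t ω))) (.conditional ℕ) := by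
  have : CompleteSpace E := FiniteDimensional.complete ℝ E
  refine ((h.isMartingaleDifference_noise hG hb).smul hc hcα).ae_summable ?_
  simpa only [mul_pow] using hα.mul_right _

end IsControlledChain

end ControlledChain

section Averaging

variable {Ω T X A E : Type*} {mΩ : MeasurableSpace Ω} {P : Measure Ω} {ℱ : Filtration ℕ mΩ}
  [PseudoMetricSpace T] [MeasurableSpace T] [MeasurableSpace X] [MeasurableSpace A]
  [NormedAddCommGroup E] [NormedSpace ℝ E]

/-- The stationary mean `∫∫ G_θ(x, y) κ_θ(x, dy) d_θ(dx)` of a family of functions. -/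
def stationaryMean {Y : Type*} [MeasurableSpace Y] (κ : Kernel (T × X) Y) (d : T → Measure X)
    (G : T → X × Y → E) (θ : T) : E :=
  ∫ x, conditionalMean κ G θ x ∂d θ

variable {κ : Kernel (T × X) (A × X)} [IsMarkovKernel κ] {θ : ℕ → Ω → T} {x : ℕ → Ω → X}
  {a : ℕ → Ω → A} [IsProbabilityMeasure P] [FiniteDimensional ℝ E] {d : T → Measure X}

/- With the Poisson solution `H` of the conditional mean of `G`, the deviation of `G` from its
stationary mean is the noise of `G + H`, plus the difference `u t - u (t + 1)` for
`u t = H_{θ t}(x t)`, plus the effect `r t` on `H` of changing the parameter. -/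
theorem IsControlledChain.ae_exists_summable_smul_sub_stationaryMean
    (h : IsControlledChain P ℱ κ θ x a) (hd : IsErgodicFamily κ.snd d)
    (hκ : IsRegularKernel E κ) {G : T → X × A × X → E} (hG : IsRegular G) {α : ℕ → ℝ}
    (hanti : Antitone α) (hα₀ : Tendsto α atTop (𝓝 0)) (hα : Summable fun t => α t ^ 2)
    (hθ : ∀ ω, Tendsto (fun t => dist (θ (t + 1) ω) (θ t ω)) atTop (𝓝 0)) :
    ∀ᵐ ω ∂P, ∃ r : ℕ → E, Tendsto r atTop (𝓝 0) ∧
      Summable (fun t => α t • (G (θ t ω) (x t ω, a t ω, x (t + 1) ω) -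
        stationaryMean κ d G (θ t ω) - r t)) (.conditional ℕ) := by
  set H := poisson κ.snd d (conditionalMean κ G)
  have hH : IsRegular H := hd.isRegular_poisson hκ.snd (hκ G hG)
  have hGH : IsRegular fun θ (q : X × A × X) => G θ q + H θ q.2.2 :=
    hG.add (hH.comp_measurable (by fun_prop))
  have hmean (θ : T) (x : X) : ∫ p, (G θ (x, p) + H θ p.2) ∂κ (θ, x) =
      H θ x + stationaryMean κ d G θ := by
    have hpush : push κ.snd H θ x = ∫ p, H θ p.2 ∂κ (θ, x) := by
      rw [push, Kernel.snd_apply, integral_map measurable_snd.aemeasurable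
        (hH.apply θ).aestronglyMeasurable]
    rw [integral_add ((hG.comp_measurable measurable_prodMk_left).integrable θ _)
      ((hH.comp_measurable measurable_snd).integrable θ _), ← hpush]
    have := hd.poisson_sub_push_poisson hκ.snd (hκ G hG) θ x
    rw [sub_eq_sub_iff_add_eq_add] at this
    rw [add_comm, stationaryMean, this, add_comm]
    rfl
  obtain ⟨b, hb⟩ := hGH.exists_norm_le
  obtain ⟨b', hb'⟩ := hH.exists_norm_le
  filter_upwards [h.ae_summable_smul_noise
    (hGH.stronglyMeasurable.comp_measurable
      (g := fun q : (T × X) × A × X => (q.1.1, q.1.2, q.2)) (by fun_prop))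
    (fun q => hb q.1.1 (q.1.2, q.2)) (c := fun t _ => α t) (fun t => stronglyMeasurable_const)
    (α := fun t => |α t|) (fun t _ => le_rfl) (by simpa only [sq_abs] using hα)] with ω hω
  refine ⟨fun t => H (θ (t + 1) ω) (x (t + 1) ω) - H (θ t ω) (x (t + 1) ω),
    hH.tendsto_sub (hθ ω) _, ?_⟩
  refine (hω.add (summable_conditional_smul_sub_succ hanti hα₀
    fun t => hb' (θ t ω) (x t ω))).congr fun t => ?_
  simp only [Function.uncurry, Function.comp_def, hmean]
  module

end Averaging

theorem summable_conditional_sum_block {E : Type*} [AddCommMonoid E] [TopologicalSpace E]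
    {v : ℕ → E} (hv : Summable v (.conditional ℕ)) {B : ℕ} (hB : 0 < B) :
    Summable (fun i => ∑ j ∈ Finset.range B, v (i * B + j)) (.conditional ℕ) := by
  have hsum (n : ℕ) : ∑ i ∈ Finset.range n, ∑ j ∈ Finset.range B, v (i * B + j) =
      ∑ t ∈ Finset.range (n * B), v t := by
    induction n with
    | zero => simp
    | succ n ih => rw [Finset.sum_range_succ, ih, Nat.succ_mul, Finset.sum_range_add]
  obtain ⟨l, hl⟩ := hv
  refine ⟨l, hasSum_conditional_nat_iff.2 ?_⟩
  simp only [hsum]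
  exact (hasSum_conditional_nat_iff.1 hl).comp (tendsto_id.atTop_mul_const' hB)

theorem mul_add_div_of_lt {B i j : ℕ} (hj : j < B) : (i * B + j) / B = i := by
  rw [mul_comm, Nat.mul_add_div (by omega), Nat.div_eq_of_lt hj, add_zero]

theorem summable_comp_div {u : ℕ → ℝ} (hu : Summable u) (hu₀ : ∀ i, 0 ≤ u i) {B : ℕ} (hB : 0 < B) :
    Summable fun t => u (t / B) := by
  have : NeZero B := ⟨hB.ne'⟩
  refine (Nat.divModEquiv B).symm.summable_iff.1 ?_
  refine (summable_prod_of_nonneg fun q => hu₀ _).2 ⟨fun i => .of_finite, ?_⟩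
  simpa [Nat.divModEquiv, mul_add_div_of_lt] using hu.mul_left (B : ℝ)

/-! ### The decision process under a policy -/

attribute [instance] CMDP.isMarkov_trans CMDP.isMarkov_shift CMDP.isProb_init

section StepKernel

variable {nS nZ nA K nθ : ℕ} {M : CMDP nS nZ nA K}

instance : IsMarkovKernel M.augTrans := by
  unfold CMDP.augTrans; infer_instance

theorem IsRegular.integral_augTrans {T E : Type*} [PseudoMetricSpace T] [MeasurableSpace T]
    [NormedAddCommGroup E] [NormedSpace ℝ E] {G : T → M.X × M.A × M.X → E} (hG : IsRegular G) :
    IsRegular fun θ (y : M.X × M.A) => ∫ x', G θ (y.1, y.2, x') ∂M.augTrans y :=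
  (hG.comp_measurable (g := fun q : (M.X × M.A) × M.X => (q.1.1, q.1.2, q.2))
    (by fun_prop)).integral_kernel M.augTrans

/-- The reshaped cost of a transition, as a family of functions that is constant in the policy
parameter. -/
def CMDP.transitionCost {T : Type*} (M : CMDP nS nZ nA K) (k : Fin (K + 1)) (_ : T)
    (q : M.X × M.A × M.X) : ℝ :=
  M.shapedCost k q.1 q.2.1 q.2.2

theorem CMDP.measurable_shapedCost (M : CMDP nS nZ nA K) (k : Fin (K + 1)) :
    Measurable fun q : M.X × M.A × M.X => M.shapedCost k q.1 q.2.1 q.2.2 := by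
  have hcost : Measurable fun q : M.X × M.A × M.X => M.cost k q.1.1 q.2.1 :=
    (M.measurable_cost k).comp (f := fun q : M.X × M.A × M.X => (q.1.1, q.2.1)) (by fun_prop)
  exact hcost.add (((M.measurable_pot k).comp (measurable_snd.comp measurable_snd)).sub
    ((M.measurable_pot k).comp measurable_fst))

namespace Policy

variable (π : Policy M nθ) (Θ : Set (EuclideanSpace ℝ (Fin nθ)))

/-- The density `π_θ(a ∣ x)` as a family, over `Θ`, of functions of `(x, a)`. -/
def densAt (θ : Θ) (y : M.X × M.A) : ℝ := π.dens θ y.1 y.2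

/-- The gradient `∇_θ π_θ(a ∣ x)` as a family, over `Θ`, of functions of `(x, a)`. -/
def gradDens (θ : Θ) (y : M.X × M.A) : EuclideanSpace ℝ (Fin nθ) :=
  gradientWithin (fun θ' => π.dens θ' y.1 y.2) Θ θ

/-- The score `∇_θ log π_θ(a ∣ x)` as a family, over `Θ`, of functions of `(x, a)`. -/
def scoreAt (θ : Θ) (y : M.X × M.A) : EuclideanSpace ℝ (Fin nθ) :=
  π.score Θ θ y.1 y.2

/-- The value function `Q_k^{π_θ}(x, a)` as a family, over `Θ`, of functions of `(x, a)`. -/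
def valueAt (k : Fin (K + 1)) (θ : Θ) (y : M.X × M.A) : ℝ := π.Q k θ y.1 y.2

/-- The policy as a kernel, jointly in the parameter and the state. -/
def polKernel : Kernel (Θ × M.X) M.A :=
  (Kernel.const _ π.ref).withDensity fun q a => ENNReal.ofReal (π.densAt Θ q.1 (q.2, a))

/-- The law of `(a_t, x_{t+1})` given `x_t`, jointly in the parameter and the state. -/
def stepKernel : Kernel (Θ × M.X) (M.A × M.X) :=
  π.polKernel Θ ⊗ₖ M.augTrans.comap (fun q : (Θ × M.X) × M.A => (q.1.2, q.2)) (by fun_prop)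

theorem nStep_eq_pow (θ : EuclideanSpace ℝ (Fin nθ)) (t : ℕ) : π.nStep θ t = π.chain θ ^ t := by
  induction t with
  | zero => rfl
  | succ t ih => rw [nStep, ih, pow_succ']; rfl

theorem Qhat_eq_add (k : Fin (K + 1)) (θ : EuclideanSpace ℝ (Fin nθ))
    (c c' : ℝ) (T : ℕ) (x : M.X) (a : M.A) :
    π.Qhat k θ c T x a = π.Qhat k θ c' T x a + T * (c' - c) := by
  simp only [Qhat, Finset.sum_sub_distrib, Finset.sum_const, Finset.card_range,
    nsmul_eq_mul]
  ring

end Policy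

theorem eq_of_hasGradientWithinAt {F : Type*} [NormedAddCommGroup F] [InnerProductSpace ℝ F]
    [CompleteSpace F] {f : F → ℝ} {s : Set F} {x g g' : F} (hs : UniqueDiffWithinAt ℝ s x)
    (hg : HasGradientWithinAt f g s x) (hg' : HasGradientWithinAt f g' s x) : g = g' :=
  (InnerProductSpace.toDual ℝ F).injective (hs.eq hg.hasFDerivWithinAt hg'.hasFDerivWithinAt)

namespace ProblemAssumptions

variable {π : Policy M nθ} {Θ : Set (EuclideanSpace ℝ (Fin nθ))} (hM : ProblemAssumptions M π Θ)
include hM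

theorem uniqueDiffOn : UniqueDiffOn ℝ Θ := uniqueDiffOn_convex hM.convex_Θ hM.interior_Θ

theorem densAt_pos (θ : Θ) (y : M.X × M.A) : 0 < π.densAt Θ θ y :=
  hM.policy_smooth.pos θ θ.2 y.1 y.2

theorem integral_densAt (θ : Θ) (x : M.X) : ∫ a, π.densAt Θ θ (x, a) ∂π.ref = 1 :=
  hM.policy_smooth.normalized θ θ.2 x

theorem hasGradientWithinAt_dens (θ : Θ) (y : M.X × M.A) :
    HasGradientWithinAt (fun θ' => π.dens θ' y.1 y.2) (π.gradDens Θ θ y) Θ θ :=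
  (hM.policy_smooth.differentiableOn y.1 y.2 θ θ.2).hasGradientWithinAt

theorem scoreAt_eq_inv_smul (θ : Θ) (y : M.X × M.A) :
    π.scoreAt Θ θ y = (π.densAt Θ θ y)⁻¹ • π.gradDens Θ θ y := by
  have hlog : HasGradientWithinAt (fun θ' => Real.log (π.dens θ' y.1 y.2))
      ((π.densAt Θ θ y)⁻¹ • π.gradDens Θ θ y) Θ θ := by
    rw [hasGradientWithinAt_iff_hasFDerivWithinAt, map_smul]
    exact (hM.hasGradientWithinAt_dens θ y).hasFDerivWithinAt.log (hM.densAt_pos θ y).ne'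
  exact eq_of_hasGradientWithinAt (hM.uniqueDiffOn θ θ.2)
    hlog.differentiableWithinAt.hasGradientWithinAt hlog

theorem densAt_smul_scoreAt (θ : Θ) (y : M.X × M.A) :
    π.densAt Θ θ y • π.scoreAt Θ θ y = π.gradDens Θ θ y := by
  rw [hM.scoreAt_eq_inv_smul, smul_inv_smul₀ (hM.densAt_pos θ y).ne']

theorem isRegular_of_continuous {E : Type*} [NormedAddCommGroup E]
    {F : Θ → M.X × M.A → E} (hF : Continuous (Function.uncurry F)) : IsRegular F := by
  have := isCompact_iff_compactSpace.1 hM.isCompact_Θ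
  have := isCompact_iff_compactSpace.1 hM.isCompact_S
  have := isCompact_iff_compactSpace.1 hM.isCompact_Z
  have := isCompact_iff_compactSpace.1 hM.isCompact_A
  exact .of_continuous hF

theorem continuous_densAt : Continuous (Function.uncurry (π.densAt Θ)) :=
  hM.policy_smooth.continuousOn.comp_continuous
    (f := fun q : Θ × M.X × M.A => ((q.1 : EuclideanSpace ℝ (Fin nθ)), q.2)) (by fun_prop)
    fun q => ⟨q.1.2, mem_univ _⟩

theorem continuous_gradDens : Continuous (Function.uncurry (π.gradDens Θ)) :=
  hM.policy_smooth.continuousOn_gradient.comp_continuous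
    (f := fun q : Θ × M.X × M.A => ((q.1 : EuclideanSpace ℝ (Fin nθ)), q.2)) (by fun_prop)
    fun q => ⟨q.1.2, mem_univ _⟩

theorem isRegular_densAt : IsRegular (π.densAt Θ) :=
  hM.isRegular_of_continuous hM.continuous_densAt

theorem isRegular_gradDens : IsRegular (π.gradDens Θ) :=
  hM.isRegular_of_continuous hM.continuous_gradDens

theorem isRegular_scoreAt : IsRegular (π.scoreAt Θ) := by
  refine hM.isRegular_of_continuous ?_
  have hscore : Function.uncurry (π.scoreAt Θ) = fun q =>
      (Function.uncurry (π.densAt Θ) q)⁻¹ • Function.uncurry (π.gradDens Θ) q :=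
    funext fun q => hM.scoreAt_eq_inv_smul q.1 q.2
  exact hscore ▸ (hM.continuous_densAt.inv₀ fun q => (hM.densAt_pos q.1 q.2).ne').smul
    hM.continuous_gradDens

theorem measurable_ofReal_densAt : Measurable (Function.uncurry fun (q : Θ × M.X) a =>
    ENNReal.ofReal (π.densAt Θ q.1 (q.2, a))) :=
  (hM.isRegular_densAt.stronglyMeasurable.measurable.comp
    (f := fun q : (Θ × M.X) × M.A => (q.1.1, q.1.2, q.2)) (by fun_prop)).ennreal_ofReal

theorem polKernel_apply (θ : Θ) (x : M.X) : π.polKernel Θ (θ, x) =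
    π.ref.withDensity fun a => ENNReal.ofReal (π.densAt Θ θ (x, a)) := by
  rw [Policy.polKernel, Kernel.withDensity_apply _ hM.measurable_ofReal_densAt, Kernel.const_apply]

theorem integrable_densAt (θ : Θ) (x : M.X) : Integrable (fun a => π.densAt Θ θ (x, a)) π.ref :=
  (hM.isRegular_densAt.comp_measurable measurable_prodMk_left).integrable θ _

theorem isMarkovKernel_polKernel : IsMarkovKernel (π.polKernel Θ) := by
  refine ⟨fun q => ⟨?_⟩⟩
  rw [hM.polKernel_apply, withDensity_apply _ .univ, Measure.restrict_univ,
    ← ofReal_integral_eq_lintegral_ofReal (hM.integrable_densAt _ _)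
      (.of_forall fun a => (hM.densAt_pos q.1 (q.2, a)).le), hM.integral_densAt, ENNReal.ofReal_one]

theorem isMarkovKernel_stepKernel : IsMarkovKernel (π.stepKernel Θ) := by
  have := hM.isMarkovKernel_polKernel
  unfold Policy.stepKernel
  infer_instance

theorem kernel_eq_sectR (θ : Θ) : π.kernel θ = (π.polKernel Θ).sectR θ := by
  ext1 x
  rw [Kernel.sectR_apply, hM.polKernel_apply, Policy.kernel, Kernel.withDensity_apply,
    Kernel.const_apply]
  · rfl
  · exact hM.measurable_ofReal_densAt.comp (f := fun q : M.X × M.A => ((θ, q.1), q.2)) (by fun_prop)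

theorem step_apply (θ : Θ) (x : M.X) : π.step θ x = π.stepKernel Θ (θ, x) := by
  have := hM.isMarkovKernel_polKernel
  rw [Policy.step, Policy.stepKernel, hM.kernel_eq_sectR]
  ext s hs
  rw [Kernel.compProd_apply hs, Kernel.compProd_apply hs]
  rfl

theorem chain_eq_sectR (θ : Θ) : π.chain θ = (π.stepKernel Θ).snd.sectR θ := by
  ext1 x
  rw [Policy.chain, Kernel.sectR_apply, Kernel.snd_apply, Kernel.snd_apply, hM.step_apply]

section Integral

variable {E : Type*} [NormedAddCommGroup E] [NormedSpace ℝ E]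

theorem integral_polKernel (θ : Θ) (x : M.X) (f : M.A → E) :
    ∫ a, f a ∂π.polKernel Θ (θ, x) = ∫ a, π.densAt Θ θ (x, a) • f a ∂π.ref := by
  have hmeas : Measurable fun a => ENNReal.ofReal (π.densAt Θ θ (x, a)) :=
    hM.measurable_ofReal_densAt.comp (measurable_prodMk_left (x := (θ, x)))
  rw [hM.polKernel_apply, integral_withDensity_eq_integral_toReal_smul hmeas
    (.of_forall fun a => ENNReal.ofReal_lt_top)]
  simp only [ENNReal.toReal_ofReal (hM.densAt_pos _ _).le]

theorem integral_stepKernel {θ : Θ} {x : M.X} {f : M.A × M.X → E}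
    (hf : Integrable f (π.stepKernel Θ (θ, x))) : ∫ p, f p ∂π.stepKernel Θ (θ, x) =
      ∫ a, π.densAt Θ θ (x, a) • ∫ x', f (a, x') ∂M.augTrans (x, a) ∂π.ref := by
  have := hM.isMarkovKernel_polKernel
  rw [← hM.integral_polKernel, Policy.stepKernel, integral_compProd hf]
  rfl

theorem conditionalMean_stepKernel {G : Θ → M.X × M.A × M.X → E} (hG : IsRegular G) (θ : Θ)
    (x : M.X) : conditionalMean (π.stepKernel Θ) G θ x = ∫ a, π.densAt Θ θ (x, a) •
      ∫ x', G θ (x, a, x') ∂M.augTrans (x, a) ∂π.ref := by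
  have := hM.isMarkovKernel_stepKernel
  exact hM.integral_stepKernel ((hG.comp_measurable measurable_prodMk_left).integrable θ _)

theorem conditionalMean_stepKernel_fst [CompleteSpace E] {F : Θ → M.X × M.A → E}
    (hF : IsRegular F) (θ : Θ) (x : M.X) :
    conditionalMean (π.stepKernel Θ) (fun θ q => F θ (q.1, q.2.1)) θ x =
      ∫ a, π.densAt Θ θ (x, a) • F θ (x, a) ∂π.ref := by
  rw [hM.conditionalMean_stepKernel (hF.comp_measurable (by fun_prop))]
  simp only [integral_const, probReal_univ, one_smul]

theorem isRegularKernel_stepKernel [ProperSpace E] : IsRegularKernel E (π.stepKernel Θ) := by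
  intro G hG
  rw [funext₂ (hM.conditionalMean_stepKernel hG)]
  exact (hM.isRegular_densAt.smul hG.integral_augTrans).integral_kernel (Kernel.const M.X π.ref)

end Integral

/-! ### Costs and value functions -/

theorem exists_isErgodicFamily : ∃ d, IsErgodicFamily (π.stepKernel Θ).snd d := by
  obtain ⟨c, -, ρ, hρ₀, hρ, h⟩ := hM.ergodic
  choose d hd hinv htv using fun θ : Θ => h θ θ.2
  refine ⟨d, hd, fun θ => hM.chain_eq_sectR θ ▸ hinv θ, fun t => (c * ρ ^ t).toNNReal, ?_,
    fun t θ x => ?_⟩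
  · exact ((summable_geometric_of_lt_one hρ₀.le hρ).mul_left c).toNNReal
  · rw [← hM.chain_eq_sectR, ← Policy.nStep_eq_pow]
    exact htv θ x t

/-- The stationary laws of the augmented states under the policies `π_θ`, `θ ∈ Θ`. -/
def stationaryLaw : Θ → Measure M.X := hM.exists_isErgodicFamily.choose

theorem isErgodicFamily : IsErgodicFamily (π.stepKernel Θ).snd hM.stationaryLaw :=
  hM.exists_isErgodicFamily.choose_spec

theorem isRegular_transitionCost (k : Fin (K + 1)) :
    IsRegular (M.transitionCost k : Θ → M.X × M.A × M.X → ℝ) :=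
  have ⟨_, hb⟩ := hM.cost_bounded
  .const (M.measurable_shapedCost k).stronglyMeasurable fun q => hb k q.1 q.2.1 q.2.2

theorem meanCost_eq_conditionalMean (k : Fin (K + 1)) (θ : Θ) (x : M.X) :
    π.meanCost k θ x = conditionalMean (π.stepKernel Θ) (M.transitionCost k) θ x := by
  rw [Policy.meanCost, hM.step_apply]
  rfl

theorem isRegular_meanCost (k : Fin (K + 1)) : IsRegular fun θ : Θ => π.meanCost k θ := by
  rw [funext fun θ : Θ => funext (hM.meanCost_eq_conditionalMean k θ)]
  exact hM.isRegularKernel_stepKernel _ (hM.isRegular_transitionCost k)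

theorem integral_nStep_meanCost (k : Fin (K + 1)) (θ : Θ) (t : ℕ) (x : M.X) :
    ∫ y, π.meanCost k θ y ∂π.nStep θ t x =
      (push (π.stepKernel Θ).snd)^[t] (fun θ : Θ => π.meanCost k θ) θ x := by
  have := hM.isMarkovKernel_stepKernel
  rw [push_iterate_eq_integral hM.isRegularKernel_stepKernel.snd (hM.isRegular_meanCost k),
    ← hM.chain_eq_sectR, ← Policy.nStep_eq_pow]

theorem tendsto_avgCost (k : Fin (K + 1)) (θ : Θ) :
    Tendsto (π.avgCost k θ) atTop (𝓝 (∫ x, π.meanCost k θ x ∂hM.stationaryLaw θ)) := by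
  have := hM.isMarkovKernel_stepKernel
  refine Tendsto.cesaro (tendsto_sub_nhds_zero_iff.1 ?_)
  simp only [hM.integral_nStep_meanCost]
  exact (hM.isErgodicFamily.hasSum_integral_poisson hM.isRegularKernel_stepKernel.snd
    (hM.isRegular_meanCost k) θ M.init).summable.tendsto_atTop_zero

theorem fdot_eq_integral (k : Fin (K + 1)) (θ : Θ) :
    π.fdot k θ = ∫ x, π.meanCost k θ x ∂hM.stationaryLaw θ :=
  (hM.tendsto_avgCost k θ).limUnder_eq

theorem fdot_eq_stationaryMean (k : Fin (K + 1)) (θ : Θ) : π.fdot k θ =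
    stationaryMean (π.stepKernel Θ) hM.stationaryLaw (M.transitionCost k) θ := by
  simp only [hM.fdot_eq_integral, hM.meanCost_eq_conditionalMean, stationaryMean]

theorem costAt_succ_eq_integral (k : Fin (K + 1)) (θ : Θ) (x : M.X) (a : M.A) (l : ℕ) :
    π.costAt k θ x a (l + 1) = ∫ x', (push (π.stepKernel Θ).snd)^[l]
      (fun θ : Θ => π.meanCost k θ) θ x' ∂M.augTrans (x, a) := by
  simp only [Policy.costAt, hM.integral_nStep_meanCost]

theorem isRegular_fdot (k : Fin (K + 1)) : IsRegular fun (θ : Θ) (_ : M.X) => π.fdot k θ := by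
  have := hM.isMarkovKernel_stepKernel
  simp only [hM.fdot_eq_integral]
  exact hM.isErgodicFamily.isRegular_integral hM.isRegularKernel_stepKernel.snd
    (hM.isRegular_meanCost k)

theorem exists_norm_costAt_sub_fdot_le (k : Fin (K + 1)) : ∃ s : ℕ → ℝ, Summable s ∧
    ∀ (θ : Θ) x a l, ‖π.costAt k θ x a l - π.fdot k θ‖ ≤ s l := by
  have := hM.isMarkovKernel_stepKernel
  have hF := hM.isRegular_meanCost k
  have hκ := hM.isRegularKernel_stepKernel.snd (E := ℝ)
  obtain ⟨s, hs, hle⟩ := hM.isErgodicFamily.exists_norm_push_iterate_sub_le hκ hF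
  obtain ⟨b, hb⟩ := (hM.isRegular_transitionCost k).integral_augTrans.exists_norm_le
  obtain ⟨b', hb'⟩ := (hM.isRegular_fdot k).exists_norm_le
  refine ⟨fun l => l.casesOn (b + b') s, (summable_nat_add_iff 1).1 hs, fun θ x a l => ?_⟩
  cases l with
  | zero => exact (norm_sub_le _ _).trans (add_le_add (hb θ (x, a)) (hb' θ x))
  | succ l =>
    have hint := (hκ.push_iterate hF l).integrable θ (M.augTrans (x, a))
    have hsub : π.costAt k θ x a (l + 1) - π.fdot k θ = ∫ x', ((push (π.stepKernel Θ).snd)^[l]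
        (fun θ : Θ => π.meanCost k θ) θ x' - π.fdot k θ) ∂M.augTrans (x, a) := by
      rw [hM.costAt_succ_eq_integral, integral_sub hint (integrable_const _), integral_const,
        probReal_univ, one_smul]
    rw [hsub, hM.fdot_eq_integral]
    simpa using norm_integral_le_of_norm_le_const (μ := M.augTrans (x, a)) (.of_forall (hle l θ))

theorem summable_costAt (k : Fin (K + 1)) (θ : Θ) (x : M.X) (a : M.A) :
    Summable fun l => π.costAt k θ x a l - π.fdot k θ :=
  have ⟨_, hs, hle⟩ := hM.exists_norm_costAt_sub_fdot_le k
  .of_norm_bounded hs (hle θ x a)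

theorem exists_norm_Q_sub_Qhat_le (k : Fin (K + 1)) : ∃ τ : ℕ → ℝ, Tendsto τ atTop (𝓝 0) ∧
    ∀ (θ : Θ) x a T, ‖π.Q k θ x a - π.Qhat k θ (π.fdot k θ) T x a‖ ≤ τ T := by
  obtain ⟨s, hs, hle⟩ := hM.exists_norm_costAt_sub_fdot_le k
  refine ⟨fun T => ∑' l, s (l + T), tendsto_sum_nat_add s, fun θ x a T => ?_⟩
  rw [Policy.Q, Policy.Qhat, ← (hM.summable_costAt k θ x a).sum_add_tsum_nat_add T,
    add_sub_cancel_left]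
  exact tsum_of_norm_bounded ((summable_nat_add_iff T).2 hs).hasSum fun l => hle θ x a (l + T)

/-- The relative value function of the average-cost problem, which solves the Poisson equation
`h = C̄ - ḟ + P h` for the mean costs `C̄` and the transition kernel `P` of the chain. -/
def relativeValue (k : Fin (K + 1)) : Θ → M.X → ℝ :=
  poisson (π.stepKernel Θ).snd hM.stationaryLaw fun θ => π.meanCost k θ

theorem isRegular_relativeValue (k : Fin (K + 1)) : IsRegular (hM.relativeValue k) :=
  have := hM.isMarkovKernel_stepKernel
  hM.isErgodicFamily.isRegular_poisson hM.isRegularKernel_stepKernel.snd (hM.isRegular_meanCost k)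

/-- The cost of a transition in excess of the long-run average, plus the relative value of the new
state. -/
def relativeCost (k : Fin (K + 1)) (θ : Θ) (q : M.X × M.A × M.X) : ℝ :=
  M.transitionCost k θ q - π.fdot k θ + hM.relativeValue k θ q.2.2

theorem isRegular_relativeCost (k : Fin (K + 1)) : IsRegular (hM.relativeCost k) :=
  ((hM.isRegular_transitionCost k).sub ((hM.isRegular_fdot k).comp_measurable measurable_fst)).add
    ((hM.isRegular_relativeValue k).comp_measurable (by fun_prop))

theorem Q_eq_integral_relativeCost (k : Fin (K + 1)) (θ : Θ) (x : M.X) (a : M.A) :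
    π.Q k θ x a = ∫ x', hM.relativeCost k θ (x, a, x') ∂M.augTrans (x, a) := by
  have := hM.isMarkovKernel_stepKernel
  have hcost : Integrable (fun x' => M.transitionCost k θ (x, a, x')) (M.augTrans (x, a)) :=
    ((hM.isRegular_transitionCost k).comp_measurable (by fun_prop)).integrable θ _
  have htail := (hM.isErgodicFamily.hasSum_integral_poisson hM.isRegularKernel_stepKernel.snd
    (hM.isRegular_meanCost k) θ (M.augTrans (x, a))).tsum_eq
  rw [← hM.fdot_eq_integral] at htail
  rw [Policy.Q, (hM.summable_costAt k θ x a).tsum_eq_zero_add]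
  simp only [hM.costAt_succ_eq_integral, htail]
  simp only [relativeCost]
  have hexcess : Integrable (fun x' => M.transitionCost k θ (x, a, x') - π.fdot k θ)
      (M.augTrans (x, a)) := hcost.sub (integrable_const _)
  rw [integral_add hexcess ((hM.isRegular_relativeValue k).integrable θ _),
    integral_sub hcost (integrable_const _), integral_const, probReal_univ, one_smul]
  rfl

theorem isRegular_valueAt (k : Fin (K + 1)) : IsRegular (π.valueAt Θ k) := by
  have hQ : π.valueAt Θ k = fun θ y => ∫ x', hM.relativeCost k θ (y.1, y.2, x') ∂M.augTrans y :=
    funext₂ fun θ y => hM.Q_eq_integral_relativeCost k θ y.1 y.2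
  exact hQ ▸ (hM.isRegular_relativeCost k).integral_augTrans

end ProblemAssumptions

end StepKernel

/-! ### The policy gradient -/

section UniformGradient

variable {V X Y : Type*} [NormedAddCommGroup V] [InnerProductSpace ℝ V] {Θ : Set V}

/-- `g x` is the gradient at `θ` of `F · x` within `Θ`, with an error in the first-order expansion
that is uniform in `x`. -/
def HasUniformGradientAt (F : Θ → X → ℝ) (g : X → V) (θ : Θ) : Prop :=
  ∀ ε > 0, ∀ᶠ θ' in 𝓝 θ, ∀ x, ‖F θ' x - F θ x - inner ℝ (θ' - θ : V) (g x)‖ ≤ ε * dist θ' θ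

namespace HasUniformGradientAt

theorem of_isRegular [CompleteSpace V] [MeasurableSpace Θ] [MeasurableSpace X] (hΘ : Convex ℝ Θ)
    {f : V → X → ℝ} {g : V → X → V} (hg : IsRegular fun θ : Θ => g θ)
    (hf : ∀ θ ∈ Θ, ∀ x, HasGradientWithinAt (fun θ => f θ x) (g θ x) Θ θ) (θ : Θ) :
    HasUniformGradientAt (fun θ : Θ => f θ) (g θ) θ := by
  intro ε hε
  obtain ⟨δ, hδ, hgδ⟩ := Metric.uniformEquicontinuous_iff.1 hg.uniformEquicontinuous ε hε
  filter_upwards [Metric.ball_mem_nhds θ hδ] with θ' hθ' x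
  have htaylor := (hΘ.inter (convex_ball (θ : V) δ)).norm_image_sub_le_of_norm_hasFDerivWithin_le'
    (f' := fun ξ => InnerProductSpace.toDual ℝ V (g ξ x))
    (φ := InnerProductSpace.toDual ℝ V (g θ x)) (C := ε)
    (fun ξ hξ => (hf ξ hξ.1 x).hasFDerivWithinAt.mono inter_subset_left)
    (fun ξ hξ => by
      rw [← map_sub, LinearIsometryEquiv.norm_map, ← dist_eq_norm]
      exact (hgδ ⟨ξ, hξ.1⟩ θ hξ.2 x).le)
    ⟨θ.2, Metric.mem_ball_self hδ⟩ ⟨θ'.2, hθ'⟩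
  rwa [InnerProductSpace.toDual_apply_apply, real_inner_comm, ← dist_eq_norm (θ' : V),
    ← Subtype.dist_eq] at htaylor

theorem mul_bdd {F : Θ → X → ℝ} {g : X → V} {θ : Θ} (h : HasUniformGradientAt F g θ) {q : X → ℝ}
    {b : ℝ} (hq : ∀ x, ‖q x‖ ≤ b) :
    HasUniformGradientAt (fun θ x => F θ x * q x) (fun x => q x • g x) θ := by
  intro ε hε
  filter_upwards [h (ε / (|b| + 1)) (by positivity)] with θ' hθ' x
  calc ‖F θ' x * q x - F θ x * q x - inner ℝ (θ' - θ : V) (q x • g x)‖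
      = ‖F θ' x - F θ x - inner ℝ (θ' - θ : V) (g x)‖ * ‖q x‖ := by
        rw [real_inner_smul_right, ← norm_mul]
        ring_nf
    _ ≤ ε / (|b| + 1) * dist θ' θ * (|b| + 1) :=
        mul_le_mul (hθ' x) ((hq x).trans ((le_abs_self b).trans (lt_add_one _).le))
          (norm_nonneg _) (by positivity)
    _ = ε * dist θ' θ := by field_simp

theorem integral [CompleteSpace V] [MeasurableSpace Y] {F : Θ → X × Y → ℝ} {g : X × Y → V} {θ : Θ}
    (h : HasUniformGradientAt F g θ) (ν : Measure Y) [IsFiniteMeasure ν]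
    (hF : ∀ θ x, Integrable (fun y => F θ (x, y)) ν) (hg : ∀ x, Integrable (fun y => g (x, y)) ν) :
    HasUniformGradientAt (fun θ x => ∫ y, F θ (x, y) ∂ν) (fun x => ∫ y, g (x, y) ∂ν) θ := by
  intro ε hε
  filter_upwards [h (ε / (ν.real univ + 1)) (by positivity)] with θ' hθ' x
  have hdiff : Integrable (fun y => F θ' (x, y) - F θ (x, y)) ν := (hF θ' x).sub (hF θ x)
  calc ‖∫ y, F θ' (x, y) ∂ν - ∫ y, F θ (x, y) ∂ν - inner ℝ (θ' - θ : V) (∫ y, g (x, y) ∂ν)‖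
      = ‖∫ y, (F θ' (x, y) - F θ (x, y) - inner ℝ (θ' - θ : V) (g (x, y))) ∂ν‖ := by
        rw [integral_sub hdiff ((hg x).const_inner _),
          integral_sub (hF θ' x) (hF θ x), integral_inner (hg x)]
    _ ≤ ε / (ν.real univ + 1) * dist θ' θ * ν.real univ :=
        norm_integral_le_of_norm_le_const (.of_forall fun y => hθ' (x, y))
    _ ≤ ε / (ν.real univ + 1) * dist θ' θ * (ν.real univ + 1) := by gcongr; exact (lt_add_one _).le
    _ = ε * dist θ' θ := by field_simp

theorem hasGradientWithinAt [CompleteSpace V] {f : V → ℝ} {g : V} {θ : Θ}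
    (h : HasUniformGradientAt (fun (θ : Θ) (_ : Unit) => f θ) (fun _ => g) θ) :
    HasGradientWithinAt f g Θ θ := by
  rw [hasGradientWithinAt_iff_hasFDerivWithinAt, hasFDerivWithinAt_iff_isLittleO, isLittleO_iff]
  intro ε hε
  rw [nhdsWithin_eq_map_subtype_coe θ.2, eventually_map]
  filter_upwards [h ε hε] with θ' hθ'
  rw [InnerProductSpace.toDual_apply_apply, real_inner_comm, ← dist_eq_norm (θ' : V),
    ← Subtype.dist_eq]
  exact hθ' ()

/- The uniformity of the expansion in `x` lets it be integrated against laws that vary with the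
parameter. -/
theorem hasGradientWithinAt_of_sub_eq_integral [CompleteSpace V] [MeasurableSpace X]
    {F : Θ → X → ℝ} {g : X → V} {θ : Θ} (h : HasUniformGradientAt F g θ) {d : Θ → Measure X}
    (hd : ∀ θ, IsProbabilityMeasure (d θ)) (hF : ∀ θ θ', Integrable (F θ) (d θ'))
    (hg : ∀ θ', Integrable g (d θ')) {f : V → ℝ}
    (hf : ∀ θ' : Θ, f θ' - f θ = ∫ x, (F θ' x - F θ x) ∂d θ')
    (hgd : Tendsto (fun θ' => ∫ x, g x ∂d θ') (𝓝 θ) (𝓝 (∫ x, g x ∂d θ))) :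
    HasGradientWithinAt f (∫ x, g x ∂d θ) Θ θ := by
  refine hasGradientWithinAt fun ε hε => ?_
  filter_upwards [h (ε / 2) (half_pos hε), Metric.tendsto_nhds.1 hgd (ε / 2) (half_pos hε)]
    with θ' hθ' hgθ' _
  have hdiff : Integrable (fun x => F θ' x - F θ x) (d θ') := (hF θ' θ').sub (hF θ θ')
  have hexpand : ‖∫ x, (F θ' x - F θ x - inner ℝ (θ' - θ : V) (g x)) ∂d θ'‖ ≤
      ε / 2 * dist θ' θ := by
    simpa using norm_integral_le_of_norm_le_const (μ := d θ') (.of_forall hθ')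
  calc ‖f θ' - f θ - inner ℝ (θ' - θ : V) (∫ x, g x ∂d θ)‖
      = ‖∫ x, (F θ' x - F θ x - inner ℝ (θ' - θ : V) (g x)) ∂d θ' +
          inner ℝ (θ' - θ : V) (∫ x, g x ∂d θ' - ∫ x, g x ∂d θ)‖ := by
        rw [integral_sub hdiff ((hg θ').const_inner _),
          integral_inner (hg θ'), hf θ', inner_sub_right]
        ring_nf
    _ ≤ ε / 2 * dist θ' θ + dist θ' θ * (ε / 2) := by
        refine norm_add_le_of_le hexpand ((norm_inner_le_norm _ _).trans ?_)
        rw [← dist_eq_norm, ← dist_eq_norm]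
        exact mul_le_mul_of_nonneg_left hgθ'.le dist_nonneg
    _ = ε * dist θ' θ := by ring

end HasUniformGradientAt

end UniformGradient

namespace ProblemAssumptions

variable {nS nZ nA K nθ : ℕ} {M : CMDP nS nZ nA K} {π : Policy M nθ}
  {Θ : Set (EuclideanSpace ℝ (Fin nθ))} (hM : ProblemAssumptions M π Θ)
include hM

theorem hasUniformGradientAt_densAt (θ : Θ) :
    HasUniformGradientAt (π.densAt Θ) (π.gradDens Θ θ) θ :=
  .of_isRegular hM.convex_Θ (f := fun θ (y : M.X × M.A) => π.dens θ y.1 y.2)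
    (g := fun θ (y : M.X × M.A) => gradientWithin (fun θ' => π.dens θ' y.1 y.2) Θ θ)
    hM.isRegular_gradDens
    (fun θ hθ => hM.hasGradientWithinAt_dens ⟨θ, hθ⟩) θ

theorem integral_gradDens (θ : Θ) (x : M.X) : ∫ a, π.gradDens Θ θ (x, a) ∂π.ref = 0 := by
  have hint (x : M.X) : Integrable (fun a => π.gradDens Θ θ (x, a)) π.ref :=
    (hM.isRegular_gradDens.comp_measurable measurable_prodMk_left).integrable θ _
  have hgrad : HasGradientWithinAt (fun _ => (1 : ℝ)) (∫ a, π.gradDens Θ θ (x, a) ∂π.ref) Θ θ :=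
    HasUniformGradientAt.hasGradientWithinAt fun ε hε =>
      (((hM.hasUniformGradientAt_densAt θ).integral π.ref hM.integrable_densAt hint) ε hε).mono
        fun θ' hθ' _ => by simpa only [hM.integral_densAt] using hθ' x
  exact eq_of_hasGradientWithinAt (hM.uniqueDiffOn θ θ.2) hgrad (hasGradientWithinAt_const _ _ _)

theorem integral_densAt_mul_valueAt (k : Fin (K + 1)) (θ θ' : Θ) (x : M.X) :
    ∫ a, π.densAt Θ θ' (x, a) * π.valueAt Θ k θ (x, a) ∂π.ref =
      π.meanCost k θ' x - π.fdot k θ +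
        push (π.stepKernel Θ).snd (fun _ => hM.relativeValue k θ) θ' x := by
  have := hM.isMarkovKernel_stepKernel
  have hcost : Integrable (fun p => M.transitionCost k θ' (x, p)) (π.stepKernel Θ (θ', x)) :=
    ((hM.isRegular_transitionCost k).comp_measurable (by fun_prop)).integrable θ' _
  have hexcess : Integrable (fun p => M.transitionCost k θ' (x, p) - π.fdot k θ)
      (π.stepKernel Θ (θ', x)) := hcost.sub (integrable_const _)
  have hvalue := (hM.isRegular_relativeValue k).apply θ
  have hsnd : Integrable (fun p : M.A × M.X => hM.relativeValue k θ p.2)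
      (π.stepKernel Θ (θ', x)) :=
    ((hM.isRegular_relativeValue k).comp_measurable measurable_snd).integrable θ _
  have hstep := hM.conditionalMean_stepKernel ((hM.isRegular_relativeCost k).freeze θ) θ' x
  simp only [smul_eq_mul, ← hM.Q_eq_integral_relativeCost] at hstep
  refine hstep.symm.trans ?_
  rw [hM.meanCost_eq_conditionalMean, push, Kernel.snd_apply,
    integral_map measurable_snd.aemeasurable hvalue.aestronglyMeasurable]
  refine (integral_add hexcess hsnd).trans ?_
  rw [integral_sub hcost (integrable_const _), integral_const, probReal_univ, one_smul]
  rfl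

theorem integral_densAt_mul_valueAt_self (k : Fin (K + 1)) (θ : Θ) (x : M.X) :
    ∫ a, π.densAt Θ θ (x, a) * π.valueAt Θ k θ (x, a) ∂π.ref = hM.relativeValue k θ x := by
  have := hM.isMarkovKernel_stepKernel
  have hpoisson := hM.isErgodicFamily.poisson_sub_push_poisson hM.isRegularKernel_stepKernel.snd
    (hM.isRegular_meanCost k) θ x
  rw [hM.integral_densAt_mul_valueAt, hM.fdot_eq_integral, ← hpoisson]
  exact sub_add_cancel _ _

/- The performance difference formula, obtained by integrating the Poisson equation of `θ` against
the stationary law of `θ'`. -/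
theorem fdot_sub_fdot (k : Fin (K + 1)) (θ θ' : Θ) : π.fdot k θ' - π.fdot k θ =
    ∫ x, (∫ a, π.densAt Θ θ' (x, a) * π.valueAt Θ k θ (x, a) ∂π.ref -
      ∫ a, π.densAt Θ θ (x, a) * π.valueAt Θ k θ (x, a) ∂π.ref) ∂hM.stationaryLaw θ' := by
  have := hM.isMarkovKernel_stepKernel
  have := hM.isErgodicFamily.isProbabilityMeasure θ'
  have hh := (hM.isRegular_relativeValue k).freeze θ
  have hcost := (hM.isRegular_meanCost k).integrable θ' (hM.stationaryLaw θ')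
  have hpush := (hM.isRegularKernel_stepKernel.snd.push hh).integrable θ' (hM.stationaryLaw θ')
  have hexcess : Integrable (fun x => π.meanCost k θ' x - π.fdot k θ) (hM.stationaryLaw θ') :=
    hcost.sub (integrable_const _)
  have hnew : Integrable (fun x => π.meanCost k θ' x - π.fdot k θ +
      push (π.stepKernel Θ).snd (fun _ => hM.relativeValue k θ) θ' x) (hM.stationaryLaw θ') :=
    hexcess.add hpush
  simp only [hM.integral_densAt_mul_valueAt_self, hM.integral_densAt_mul_valueAt]
  rw [integral_sub hnew (hh.integrable θ' _), integral_add hexcess hpush,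
    integral_sub hcost (integrable_const _), hM.isErgodicFamily.integral_push hh,
    ← hM.fdot_eq_integral, integral_const, probReal_univ, one_smul, add_sub_cancel_right]

theorem gradF_eq_integral (k : Fin (K + 1)) (θ : Θ) : π.gradF Θ k θ =
    ∫ x, ∫ a, π.valueAt Θ k θ (x, a) • π.gradDens Θ θ (x, a) ∂π.ref ∂hM.stationaryLaw θ := by
  have hdens := hM.isRegular_densAt.smul ((hM.isRegular_valueAt k).freeze θ)
  have hgrad := ((hM.isRegular_valueAt k).smul hM.isRegular_gradDens).freeze θ
  obtain ⟨b, hb⟩ := (hM.isRegular_valueAt k).exists_norm_le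
  have hint (θ' : Θ) (x : M.X) :
      Integrable (fun a => π.densAt Θ θ' (x, a) * π.valueAt Θ k θ (x, a)) π.ref :=
    (hdens.comp_measurable measurable_prodMk_left).integrable θ' _
  have hexpand := ((hM.hasUniformGradientAt_densAt θ).mul_bdd (hb θ)).integral π.ref hint
    fun x => (hgrad.comp_measurable measurable_prodMk_left).integrable θ _
  have hmean := hdens.integral_kernel (Kernel.const M.X π.ref)
  have hmeanGrad := hgrad.integral_kernel (Kernel.const M.X π.ref)
  have hprob := hM.isErgodicFamily.isProbabilityMeasure
  have := hM.isMarkovKernel_stepKernel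
  obtain ⟨x₀⟩ := nonempty_of_isProbabilityMeasure (hM.stationaryLaw θ)
  have hcont := (hM.isErgodicFamily.isRegular_integral hM.isRegularKernel_stepKernel.snd
    hmeanGrad).uniformEquicontinuous.uniformContinuous x₀
  exact eq_of_hasGradientWithinAt (hM.uniqueDiffOn θ θ.2)
    (hM.differentiable k θ θ.2).hasGradientWithinAt
    (hexpand.hasGradientWithinAt_of_sub_eq_integral hprob
      (fun θ₁ θ₂ => hmean.integrable θ₁ (hM.stationaryLaw θ₂))
      (fun θ' => hmeanGrad.integrable θ (hM.stationaryLaw θ')) (hM.fdot_sub_fdot k θ)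
      hcont.continuous.continuousAt)

theorem gradF_eq_stationaryMean (k : Fin (K + 1)) (θ : Θ) : π.gradF Θ k θ =
    stationaryMean (π.stepKernel Θ) hM.stationaryLaw
      (fun θ q => π.valueAt Θ k θ (q.1, q.2.1) • π.scoreAt Θ θ (q.1, q.2.1)) θ := by
  have hreg := (hM.isRegular_valueAt k).smul hM.isRegular_scoreAt
  rw [hM.gradF_eq_integral, stationaryMean]
  simp only [hM.conditionalMean_stepKernel_fst hreg, smul_comm (π.densAt Θ θ _),
    hM.densAt_smul_scoreAt]

end ProblemAssumptions

/-! ### Runs of the algorithm -/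

/-- The properties of the averaging steps `η` and of the update steps `μ` that let the averages
track the moving parameter. -/
structure TrackingSteps (η μ : ℕ → ℝ) : Prop where
  antitone_η : Antitone η
  pos_η : ∀ i, 0 < η i
  not_summable_η : ¬Summable η
  summable_sq_η : Summable fun i => η i ^ 2
  nonneg_μ : ∀ i, 0 ≤ μ i
  le_one_μ : ∀ i, μ i ≤ 1
  isLittleO_μ_η : μ =o[atTop] η

theorem StepSizeAssumptions.trackingSteps {η μ : ℕ → ℝ} (hs : StepSizeAssumptions η μ) :
    TrackingSteps η μ where
  antitone_η := hs.antitone_η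
  pos_η := hs.pos_η
  not_summable_η hη := by
    obtain ⟨ϱ, -, hϱ, hO⟩ := hs.inv_η
    have hinv : (fun i : ℕ => ((i : ℝ) ^ ϱ)⁻¹) =O[atTop] η := by
      simpa using hO.inv_rev (.of_forall fun i hi => by simp [(hs.pos_η i).ne'] at hi)
    exact hϱ.not_gt (Real.summable_nat_rpow_inv.1 (summable_of_isBigO_nat hη hinv))
  summable_sq_η := hs.sum_sq_η
  nonneg_μ i := (hs.pos_μ i).le
  le_one_μ := hs.le_one_μ
  isLittleO_μ_η := (isLittleO_iff_tendsto fun i hi => absurd hi (hs.pos_η i).ne').2 <| by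
    simpa only [div_eq_mul_inv] using hs.tendsto_ratio

theorem TrackingSteps.tendsto_η {η μ : ℕ → ℝ} (hs : TrackingSteps η μ) :
    Tendsto η atTop (𝓝 0) := by
  simpa [Real.sqrt_sq (hs.pos_η _).le] using hs.summable_sq_η.tendsto_atTop_zero.sqrt

theorem TrackingSteps.tendsto_μ {η μ : ℕ → ℝ} (hs : TrackingSteps η μ) :
    Tendsto μ atTop (𝓝 0) :=
  hs.isLittleO_μ_η.trans_tendsto hs.tendsto_η

section BlockMean

variable {E : Type*} [NormedAddCommGroup E] [NormedSpace ℝ E] {B : ℕ}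

/-- The mean of a sequence over the `i`-th block `iB, …, iB + B - 1` of indices. -/
def blockMean (B : ℕ) (v : ℕ → E) (i : ℕ) : E :=
  (B : ℝ)⁻¹ • ∑ j ∈ Finset.range B, v (i * B + j)

theorem blockMean_congr {v v' : ℕ → E} {i : ℕ} (h : ∀ j < B, v (i * B + j) = v' (i * B + j)) :
    blockMean B v i = blockMean B v' i :=
  congrArg _ (Finset.sum_congr rfl fun j hj => h j (Finset.mem_range.1 hj))

theorem blockMean_add (v v' : ℕ → E) (i : ℕ) :
    blockMean B (fun t => v t + v' t) i = blockMean B v i + blockMean B v' i := by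
  simp only [blockMean, Finset.sum_add_distrib, smul_add]

theorem blockMean_sub (v v' : ℕ → E) (i : ℕ) :
    blockMean B (fun t => v t - v' t) i = blockMean B v i - blockMean B v' i := by
  simp only [blockMean, Finset.sum_sub_distrib, smul_sub]

theorem blockMean_comp_div_smul (c : ℕ → ℝ) (v : ℕ → E) (i : ℕ) :
    blockMean B (fun t => c (t / B) • v t) i = c i • blockMean B v i := by
  rw [blockMean_congr (v' := fun t => c i • v t) fun j hj => by rw [mul_add_div_of_lt hj]]
  simp only [blockMean, ← Finset.smul_sum, smul_comm (c i)]

theorem blockMean_comp_div (hB : 0 < B) (v : ℕ → E) (i : ℕ) :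
    blockMean B (fun t => v (t / B)) i = v i := by
  rw [blockMean_congr (v' := fun _ => v i) fun j hj => by rw [mul_add_div_of_lt hj]]
  simp [blockMean, ← Nat.cast_smul_eq_nsmul ℝ, hB.ne']

theorem enorm_blockMean_le (hB : 0 < B) {v : ℕ → E} {i : ℕ} {c : ℝ≥0∞}
    (h : ∀ j < B, ‖v (i * B + j)‖ₑ ≤ c) : ‖blockMean B v i‖ₑ ≤ c := by
  have hsum : ‖∑ j ∈ Finset.range B, v (i * B + j)‖ₑ ≤ B * c := by
    refine (enorm_sum_le _ _).trans ((Finset.sum_le_sum fun j hj =>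
      h j (Finset.mem_range.1 hj)).trans_eq ?_)
    simp
  have hB' : (B : ℝ≥0∞) ≠ 0 := Nat.cast_ne_zero.2 hB.ne'
  calc ‖blockMean B v i‖ₑ ≤ (B : ℝ≥0∞)⁻¹ * (B * c) := by
        rw [blockMean, enorm_smul, enorm_inv (Nat.cast_ne_zero.2 hB.ne')]
        gcongr
        simp
    _ = c := ENNReal.inv_mul_cancel_left hB' (ENNReal.natCast_ne_top B)

theorem tendsto_blockMean_zero (hB : 0 < B) {v : ℕ → E} (hv : Tendsto v atTop (𝓝 0)) :
    Tendsto (blockMean B v) atTop (𝓝 0) := by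
  have hsum : Tendsto (fun i => ∑ j ∈ Finset.range B, v (i * B + j)) atTop (𝓝 0) := by
    simpa using tendsto_finsetSum (Finset.range B) fun j _ =>
      hv.comp (tendsto_atTop_mono (fun i => Nat.le_add_right (i * B) j)
        (tendsto_id.atTop_mul_const' hB))
  rw [← smul_zero (B : ℝ)⁻¹]
  exact hsum.const_smul _

theorem summable_conditional_smul_blockMean (hB : 0 < B) {c : ℕ → ℝ} {v : ℕ → E}
    (h : Summable (fun t => c (t / B) • v t) (.conditional ℕ)) :
    Summable (fun i => c i • blockMean B v i) (.conditional ℕ) :=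
  ((summable_conditional_sum_block h hB).const_smul (B : ℝ)⁻¹).congr
    fun i => blockMean_comp_div_smul c v i

end BlockMean

theorem IsActorSolution.mem {n K : ℕ} {Θ : Set (EuclideanSpace ℝ (Fin n))}
    {F : Fin (K + 1) → EuclideanSpace ℝ (Fin n) → ℝ} {θb : EuclideanSpace ℝ (Fin n)}
    (h : IsActorSolution Θ F θb) : θb ∈ Θ := by
  by_cases hfeasible : ∃ θ ∈ Θ, ∀ k : Fin K, F k.succ θ ≤ 0
  · exact (h.1 hfeasible).1
  · exact (h.2 hfeasible).1

variable {nS nZ nA K nθ nω : ℕ} {M : CMDP nS nZ nA K} {π : Policy M nθ}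
  {Θ : Set (EuclideanSpace ℝ (Fin nθ))} {B : ℕ} {η μ : ℕ → ℝ} {ζ : Fin (K + 1) → ℝ}
  {Qnet : Fin (K + 1) → EuclideanSpace ℝ (Fin nω) → M.X → M.A → ℝ}
  {Ω : Type*} [mΩ : MeasurableSpace Ω] {P : Measure Ω}

namespace ProblemAssumptions

variable (hM : ProblemAssumptions M π Θ)
include hM

theorem exists_lipschitzWith_fdot (k : Fin (K + 1)) :
    ∃ L, LipschitzWith L fun θ : Θ => π.fdot k θ := by
  obtain ⟨c, hc⟩ := hM.gradient_bounded
  refine ⟨c.toNNReal, (hM.convex_Θ.lipschitzOnWith_of_nnnorm_hasFDerivWithin_le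
    (f' := fun θ => InnerProductSpace.toDual ℝ _ (π.gradF Θ k θ)) (fun θ hθ =>
      (hM.differentiable k θ hθ).hasGradientWithinAt.hasFDerivWithinAt) fun θ hθ => ?_).to_restrict⟩
  rw [LinearIsometryEquiv.nnnorm_map]
  exact NNReal.le_toNNReal_of_coe_le (hc k θ hθ)

theorem exists_lipschitzWith_gradF (k : Fin (K + 1)) :
    ∃ L, LipschitzWith L fun θ : Θ => π.gradF Θ k θ :=
  have ⟨L, hL⟩ := hM.gradient_lipschitz
  ⟨L, (hL k).to_restrict⟩

theorem conditionalMean_scoreAt (θ : Θ) (x : M.X) :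
    conditionalMean (π.stepKernel Θ) (fun θ q => π.scoreAt Θ θ (q.1, q.2.1)) θ x = 0 := by
  rw [hM.conditionalMean_stepKernel_fst hM.isRegular_scoreAt]
  simp only [hM.densAt_smul_scoreAt, hM.integral_gradDens]

end ProblemAssumptions

namespace Run

variable (R : Run M π Θ B η μ ζ Qnet P)

/-- The score `∇_θ log π_{θ_i}(a_t ∣ x_t)` of the action at time `t ∈ {iB, …, iB + B - 1}`. -/
def score (t : ℕ) (ω : Ω) : EuclideanSpace ℝ (Fin nθ) :=
  π.score Θ (R.θ (t / B) ω) (R.x t ω) (R.a t ω)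

theorem ghat_succ_eq_blockMean (i : ℕ) (ω : Ω) (k : Fin (K + 1)) :
    R.ghat (i + 1) ω k = (1 - η (i + 1)) • R.ghat i ω k + η i • blockMean B
      (fun t => Qnet k (R.w (t / B) ω k) (R.x t ω) (R.a t ω) • R.score t ω) i := by
  rw [R.ghat_succ, blockMean_congr (v' := fun t =>
    Qnet k (R.w i ω k) (R.x t ω) (R.a t ω) • π.score Θ (R.θ i ω) (R.x t ω) (R.a t ω))
    fun j hj => by rw [score, mul_add_div_of_lt hj]]
  rfl

theorem measurable_fhat (k : Fin (K + 1)) (i : ℕ) :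
    Measurable[R.ℱ (i * B)] fun ω => R.fhat i ω k := by
  induction i with
  | zero =>
    rw [zero_mul]
    exact (measurable_pi_apply k).comp R.measurable_fhat_zero
  | succ i ih =>
    have hcost : ∀ j ∈ Finset.range B, Measurable[R.ℱ ((i + 1) * B)] fun ω =>
        M.shapedCost k (R.x (i * B + j) ω) (R.a (i * B + j) ω) (R.x (i * B + j + 1) ω) := by
      intro j hj
      have hle : i * B + j + 1 ≤ (i + 1) * B := by
        have := Finset.mem_range.1 hj
        rw [Nat.succ_mul]
        omega
      have hx := R.measurable_x (i * B + j) |>.mono (R.ℱ.mono ((Nat.le_succ _).trans hle)) le_rfl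
      have ha := R.measurable_a (i * B + j) |>.mono (R.ℱ.mono hle) le_rfl
      have hx' := R.measurable_x (i * B + j + 1) |>.mono (R.ℱ.mono hle) le_rfl
      exact (M.measurable_shapedCost k).comp (hx.prodMk (ha.prodMk hx'))
    simp_rw [R.fhat_succ]
    have hfhat := ih.mono (R.ℱ.mono (Nat.mul_le_mul_right B i.le_succ)) le_rfl
    exact (hfhat.const_mul _).add
      (((Finset.measurable_fun_sum (Finset.range B) hcost).const_mul _).const_mul _)

variable (hM : ProblemAssumptions M π Θ) (hs : TrackingSteps η μ)
include hM hs

theorem θ_mem (i : ℕ) (ω : Ω) : R.θ i ω ∈ Θ := by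
  induction i with
  | zero => exact R.θ_zero ω
  | succ i ih =>
    rw [R.θ_succ]
    exact hM.convex_Θ ih (R.θbar_spec i ω).mem (sub_nonneg.2 (hs.le_one_μ _)) (hs.nonneg_μ _)
      (sub_add_cancel _ _)

/-- The iterate `θ_i` as a point of `Θ`. -/
def par (i : ℕ) (ω : Ω) : Θ := ⟨R.θ i ω, R.θ_mem hM hs i ω⟩

theorem dist_par_succ_le (i : ℕ) (ω : Ω) :
    dist (R.par hM hs (i + 1) ω) (R.par hM hs i ω) ≤ Metric.diam Θ * μ (i + 1) := by
  have hdiff : R.θ (i + 1) ω - R.θ i ω = μ (i + 1) • (R.θbar i ω - R.θ i ω) := by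
    rw [R.θ_succ]
    module
  change dist (R.θ (i + 1) ω) (R.θ i ω) ≤ _
  rw [dist_eq_norm, hdiff, norm_smul, Real.norm_of_nonneg (hs.nonneg_μ _), mul_comm, ← dist_eq_norm]
  exact mul_le_mul_of_nonneg_right (Metric.dist_le_diam_of_mem hM.isCompact_Θ.isBounded
    (R.θbar_spec i ω).mem (R.θ_mem hM hs i ω)) (hs.nonneg_μ _)

theorem tendsto_dist_par_div (hB : 0 < B) (ω : Ω) : Tendsto (fun t =>
    dist (R.par hM hs ((t + 1) / B) ω) (R.par hM hs (t / B) ω)) atTop (𝓝 0) := by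
  have hμ : Tendsto (fun t => Metric.diam Θ * μ (t / B + 1)) atTop (𝓝 0) := by
    simpa using (((tendsto_add_atTop_iff_nat 1).2 hs.tendsto_μ).comp
      (Nat.tendsto_div_const_atTop hB.ne')).const_mul (Metric.diam Θ)
  refine squeeze_zero (fun _ => dist_nonneg) (fun t => ?_) hμ
  rw [Nat.succ_div]
  split_ifs
  · exact R.dist_par_succ_le hM hs _ ω
  · simpa using mul_nonneg Metric.diam_nonneg (hs.nonneg_μ _)

theorem measurable_par (i : ℕ) : Measurable[R.ℱ (i * B)] (R.par hM hs i) :=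
  (R.measurable_θ i).subtype_mk

theorem isControlledChain : IsControlledChain P R.ℱ (π.stepKernel Θ)
    (fun t => R.par hM hs (t / B)) R.x R.a where
  measurable_θ t := (R.measurable_par hM hs _).mono (R.ℱ.mono (Nat.div_mul_le_self t B)) le_rfl
  measurable_x := R.measurable_x
  measurable_a := R.measurable_a
  isCondLaw t U hU := by
    refine (R.law_step t U hU).trans (.of_forall fun ω => ?_)
    simp only [← hM.step_apply, par]

section Averaging

variable {E : Type*} [NormedAddCommGroup E] [NormedSpace ℝ E]

theorem limsup_enorm_sub_le [CompleteSpace E] {F : Θ → E} {L : ℝ≥0} (hF : LipschitzWith L F)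
    {ω : Ω} {est β r : ℕ → E} (hrec : ∀ i, est (i + 1) = (1 - η (i + 1)) • est i + η i • β i)
    (hsum : Summable (fun i => η i • (β i - F (R.par hM hs i ω) - r i)) (.conditional ℕ)) :
    limsup (fun i => ‖est i - F (R.par hM hs i ω)‖ₑ) atTop ≤ limsup (fun i => ‖r i‖ₑ) atTop := by
  have := isCompact_iff_compactSpace.1 hM.isCompact_Θ
  obtain ⟨b, hb⟩ := (isCompact_range hF.continuous).isBounded.exists_norm_le
  have hdrift : (fun i => F (R.par hM hs (i + 1) ω) - F (R.par hM hs i ω)) =O[atTop]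
      fun i => μ (i + 1) := by
    refine .of_bound (L * Metric.diam Θ) (.of_forall fun i => ?_)
    rw [← dist_eq_norm, Real.norm_of_nonneg (hs.nonneg_μ _), mul_assoc]
    exact (hF.dist_le_mul _ _).trans
      (mul_le_mul_of_nonneg_left (R.dist_par_succ_le hM hs i ω) L.2)
  exact limsup_enorm_sub_le_of_tracking hs.antitone_η hs.pos_η hs.tendsto_η hs.not_summable_η
    (fun i => hb _ (mem_range_self _))
    (hdrift.trans_isLittleO (hs.isLittleO_μ_η.comp_tendsto (tendsto_add_atTop_nat 1))) hrec hsum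

theorem ae_exists_summable_smul_blockMean_sub [IsProbabilityMeasure P] [FiniteDimensional ℝ E]
    (hB : 0 < B) {G : Θ → M.X × M.A × M.X → E} (hG : IsRegular G) :
    ∀ᵐ ω ∂P, ∃ r : ℕ → E, Tendsto r atTop (𝓝 0) ∧ Summable (fun i => η i •
      (blockMean B (fun t => G (R.par hM hs (t / B) ω) (R.x t ω, R.a t ω, R.x (t + 1) ω)) i -
        stationaryMean (π.stepKernel Θ) hM.stationaryLaw G (R.par hM hs i ω) - r i))
      (.conditional ℕ) := by
  have := hM.isMarkovKernel_stepKernel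
  have : ProperSpace E := FiniteDimensional.proper ℝ E
  filter_upwards [(R.isControlledChain hM hs).ae_exists_summable_smul_sub_stationaryMean
    hM.isErgodicFamily hM.isRegularKernel_stepKernel hG
    (hs.antitone_η.comp_monotone fun _ _ => Nat.div_le_div_right (c := B))
    (hs.tendsto_η.comp (Nat.tendsto_div_const_atTop hB.ne'))
    (summable_comp_div hs.summable_sq_η (fun _ => sq_nonneg _) hB)
    (R.tendsto_dist_par_div hM hs hB)] with ω ⟨r, hr, hsum⟩
  refine ⟨blockMean B r, tendsto_blockMean_zero hB hr, ?_⟩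
  refine (summable_conditional_smul_blockMean hB hsum).congr fun i => ?_
  rw [blockMean_sub, blockMean_sub, blockMean_comp_div hB fun i =>
    stationaryMean (π.stepKernel Θ) hM.stationaryLaw G (R.par hM hs i ω)]

end Averaging

variable [IsProbabilityMeasure P]

theorem ae_tendsto_fhat_sub_fdot (hB : 0 < B) (k : Fin (K + 1)) :
    ∀ᵐ ω ∂P, Tendsto (fun i => |R.fhat i ω k - π.fdot k (R.θ i ω)|) atTop (𝓝 0) := by
  obtain ⟨L, hL⟩ := hM.exists_lipschitzWith_fdot k
  filter_upwards [R.ae_exists_summable_smul_blockMean_sub hM hs hB (hM.isRegular_transitionCost k)]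
    with ω ⟨r, hr, hsum⟩
  simp only [← hM.fdot_eq_stationaryMean] at hsum
  have hlim := R.limsup_enorm_sub_le hM hs hL (est := fun i => R.fhat i ω k)
    (fun i => R.fhat_succ i ω k) hsum
  rw [show limsup (fun i => ‖r i‖ₑ) atTop = 0 by simpa using hr.enorm.limsup_eq] at hlim
  have henorm := tendsto_of_le_liminf_of_limsup_le zero_le hlim
  simpa [Function.comp_def, toReal_enorm, par] using
    (ENNReal.tendsto_toReal ENNReal.zero_ne_top).comp henorm

theorem ae_exists_summable_smul_policyGradient_sub (hB : 0 < B) (k : Fin (K + 1)) :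
    ∀ᵐ ω ∂P, ∃ r : ℕ → EuclideanSpace ℝ (Fin nθ), Tendsto r atTop (𝓝 0) ∧
      Summable (fun i => η i •
        (blockMean B (fun t => π.Q k (R.θ (t / B) ω) (R.x t ω) (R.a t ω) • R.score t ω) i -
          π.gradF Θ k (R.θ i ω) - r i)) (.conditional ℕ) := by
  have hG := ((hM.isRegular_valueAt k).smul hM.isRegular_scoreAt).comp_measurable
    (g := fun q : M.X × M.A × M.X => (q.1, q.2.1)) (by fun_prop)
  filter_upwards [R.ae_exists_summable_smul_blockMean_sub hM hs hB hG] with ω ⟨r, hr, hsum⟩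
  simp only [← hM.gradF_eq_stationaryMean] at hsum
  exact ⟨r, hr, hsum⟩

theorem ae_summable_smul_score_of_abs_le (hB : 0 < B) {δ : ℕ → Ω → ℝ} {b : ℝ}
    (hδ : ∀ i, Measurable[R.ℱ (i * B)] (δ i)) (hb : ∀ i ω, |δ i ω| ≤ b) :
    ∀ᵐ ω ∂P, Summable (fun i => (η i * δ i ω) • blockMean B (fun t => R.score t ω) i)
      (.conditional ℕ) := by
  have := hM.isMarkovKernel_stepKernel
  obtain ⟨C, hC⟩ := hM.isRegular_scoreAt.exists_norm_le
  filter_upwards [(R.isControlledChain hM hs).ae_summable_smul_noise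
    (G := fun q : (Θ × M.X) × M.A × M.X => π.scoreAt Θ q.1.1 (q.1.2, q.2.1))
    (hM.isRegular_scoreAt.stronglyMeasurable.comp_measurable
      (g := fun q : (Θ × M.X) × M.A × M.X => (q.1.1, q.1.2, q.2.1)) (by fun_prop))
    (fun q => hC _ _) (c := fun t ω => η (t / B) * δ (t / B) ω) (α := fun t => η (t / B) * b)
    (fun t => ((hδ (t / B)).mono (R.ℱ.mono (Nat.div_mul_le_self t B)) le_rfl
      |>.const_mul _).stronglyMeasurable)
    (fun t ω => by
      rw [abs_mul, abs_of_pos (hs.pos_η _)]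
      exact mul_le_mul_of_nonneg_left (hb _ ω) (hs.pos_η _).le)
    (by simpa only [mul_pow] using
      (summable_comp_div hs.summable_sq_η (fun _ => sq_nonneg _) hB).mul_right _)] with ω hω
  refine summable_conditional_smul_blockMean hB (c := fun i => η i * δ i ω) (hω.congr fun t => ?_)
  have hmean := hM.conditionalMean_scoreAt (R.par hM hs (t / B) ω) (R.x t ω)
  rw [conditionalMean] at hmean
  rw [hmean, sub_zero]
  rfl

/- Truncating `δ` at a natural number makes its bound deterministic. -/
theorem ae_summable_smul_score (hB : 0 < B) {δ : ℕ → Ω → ℝ}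
    (hδ : ∀ i, Measurable[R.ℱ (i * B)] (δ i)) :
    ∀ᵐ ω ∂P, (∃ b, ∀ i, |δ i ω| ≤ b) →
      Summable (fun i => (η i * δ i ω) • blockMean B (fun t => R.score t ω) i)
        (.conditional ℕ) := by
  have htrunc (n : ℕ) := R.ae_summable_smul_score_of_abs_le hM hs hB
    (δ := fun i ω => if |δ i ω| ≤ n then δ i ω else 0) (b := n)
    (fun i => .ite (measurableSet_le (measurable_norm.comp (hδ i)) measurable_const) (hδ i)
      measurable_const)
    fun i ω => by split_ifs with h <;> simp [h]
  filter_upwards [ae_all_iff.2 htrunc] with ω hω ⟨b, hb⟩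
  obtain ⟨n, hn⟩ := exists_nat_ge b
  simpa only [(hb _).trans hn, if_true] using hω n

end Run

/-! ### Gradient estimates -/

namespace Run

variable (R : Run M π Θ B η μ ζ Qnet P) (hM : ProblemAssumptions M π Θ) (hs : TrackingSteps η μ)
  {C : ℝ} (hC : ∀ θ y, ‖π.scoreAt Θ θ y‖ ≤ C) (hB : 0 < B)
include hM hs hC hB

theorem limsup_enorm_blockMean_smul_score_le {q : ℕ → ℝ} {ω : Ω} {dev : ℕ → ℝ≥0∞} {τ : ℕ → ℝ}
    (hτ : Tendsto τ atTop (𝓝 0)) (hq : ∀ i, ∀ j < B, ‖q (i * B + j)‖ₑ ≤ dev i + ‖τ i‖ₑ) :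
    limsup (fun i => ‖blockMean B (fun t => q t • R.score t ω) i‖ₑ) atTop ≤
      ENNReal.ofReal C * limsup dev atTop := by
  have hscore (t : ℕ) : ‖R.score t ω‖ ≤ C := hC (R.par hM hs (t / B) ω) (R.x t ω, R.a t ω)
  have hmean (i : ℕ) : ‖blockMean B (fun t => q t • R.score t ω) i‖ₑ ≤
      ENNReal.ofReal C * (dev i + ‖τ i‖ₑ) := by
    refine enorm_blockMean_le hB fun j hj => ?_
    rw [enorm_smul, mul_comm, ← ofReal_norm (R.score _ _)]
    gcongr
    exacts [hscore _, hq i j hj]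
  calc limsup (fun i => ‖blockMean B (fun t => q t • R.score t ω) i‖ₑ) atTop
      ≤ limsup (fun i => ENNReal.ofReal C * (dev i + ‖τ i‖ₑ)) atTop :=
        limsup_le_limsup (.of_forall hmean)
    _ = ENNReal.ofReal C * limsup dev atTop := by
        rw [ENNReal.limsup_const_mul_of_ne_top ENNReal.ofReal_ne_top]
        congr 1
        exact ENNReal.limsup_add_of_right_tendsto_zero (by simpa using hτ.enorm) _

/- The baseline `δ i` multiplies scores, which average out, so only the remaining error of the
Q-network acts on the estimate as a bias. -/
theorem limsup_enorm_ghat_sub_gradF_le {k : Fin (K + 1)} {ω : Ω}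
    {r : ℕ → EuclideanSpace ℝ (Fin nθ)} (hr : Tendsto r atTop (𝓝 0))
    (hgrad : Summable (fun i => η i •
      (blockMean B (fun t => π.Q k (R.θ (t / B) ω) (R.x t ω) (R.a t ω) • R.score t ω) i -
        π.gradF Θ k (R.θ i ω) - r i)) (.conditional ℕ))
    {δ : ℕ → ℝ} (hscore : Summable (fun i =>
      (η i * δ i) • blockMean B (fun t => R.score t ω) i) (.conditional ℕ))
    {Qt : ℕ → M.X → M.A → ℝ} {τ : ℕ → ℝ} (hτ : Tendsto τ atTop (𝓝 0))
    (hQt : ∀ i x a, ‖Qt i x a - π.Q k (R.θ i ω) x a - δ i‖ ≤ τ i) :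
    limsup (fun i => ‖R.ghat i ω k - π.gradF Θ k (R.θ i ω)‖ₑ) atTop ≤
      ENNReal.ofReal C *
        limsup (fun i => ⨆ x, ⨆ a, ‖Qnet k (R.w i ω k) x a - Qt i x a‖ₑ) atTop := by
  set err : ℕ → ℕ → ℝ := fun i t => Qnet k (R.w i ω k) (R.x t ω) (R.a t ω) -
    π.Q k (R.θ i ω) (R.x t ω) (R.a t ω) - δ i
  set bias := blockMean B fun t => err (t / B) t • R.score t ω
  set dev : ℕ → ℝ≥0∞ := fun i => ⨆ x, ⨆ a, ‖Qnet k (R.w i ω k) x a - Qt i x a‖ₑ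
  have herr (i t : ℕ) : ‖err i t‖ₑ ≤ dev i + ‖τ i‖ₑ := by
    set x := R.x t ω
    set a := R.a t ω
    calc ‖err i t‖ₑ
        = ‖(Qnet k (R.w i ω k) x a - Qt i x a) + (Qt i x a - π.Q k (R.θ i ω) x a - δ i)‖ₑ := by
          congr 1
          ring
      _ ≤ dev i + ‖τ i‖ₑ := (enorm_add_le _ _).trans (add_le_add
          (le_iSup₂ (f := fun x a => ‖Qnet k (R.w i ω k) x a - Qt i x a‖ₑ) x a)
          (enorm_le_iff_norm_le.2 ((hQt i x a).trans (le_abs_self _))))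
  have hsplit (i : ℕ) :
      blockMean B (fun t => Qnet k (R.w (t / B) ω k) (R.x t ω) (R.a t ω) • R.score t ω) i =
        bias i + blockMean B (fun t => π.Q k (R.θ (t / B) ω) (R.x t ω) (R.a t ω) • R.score t ω) i +
          δ i • blockMean B (fun t => R.score t ω) i := by
    rw [← blockMean_comp_div_smul, ← blockMean_add, ← blockMean_add]
    exact blockMean_congr fun j _ => by module
  obtain ⟨L, hL⟩ := hM.exists_lipschitzWith_gradF k
  calc limsup (fun i => ‖R.ghat i ω k - π.gradF Θ k (R.θ i ω)‖ₑ) atTop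
      ≤ limsup (fun i => ‖bias i + r i‖ₑ) atTop :=
        R.limsup_enorm_sub_le hM hs hL (est := fun i => R.ghat i ω k) (r := fun i => bias i + r i)
          (fun i => R.ghat_succ_eq_blockMean i ω k)
          ((hgrad.add hscore).congr fun i => by rw [hsplit, par]; module)
    _ ≤ limsup (fun i => ‖bias i‖ₑ) atTop :=
        limsup_enorm_le_of_tendsto_sub_zero (by simpa using hr)
    _ ≤ ENNReal.ofReal C * limsup dev atTop :=
        R.limsup_enorm_blockMean_smul_score_le hM hs hC hB hτ fun i j hj => by
          rw [mul_add_div_of_lt hj]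
          exact herr i _

variable [IsProbabilityMeasure P]

theorem ae_limsup_enorm_ghat_sub_gradF_le_Q (k : Fin (K + 1)) :
    ∀ᵐ ω ∂P, limsup (fun i => ‖R.ghat i ω k - π.gradF Θ k (R.θ i ω)‖ₑ) atTop ≤
      ENNReal.ofReal C * limsup (fun i => ⨆ x, ⨆ a,
        ‖Qnet k (R.w i ω k) x a - π.Q k (R.θ i ω) x a‖ₑ) atTop := by
  filter_upwards [R.ae_exists_summable_smul_policyGradient_sub hM hs hB k] with ω ⟨r, hr, hgrad⟩
  exact R.limsup_enorm_ghat_sub_gradF_le hM hs hC hB hr hgrad (δ := 0) (by simp)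
    (Qt := fun i => π.Q k (R.θ i ω)) (τ := 0) tendsto_const_nhds (by simp)

/- Replacing `ḟ_k(θ_i)` by its estimate shifts the truncated value function by a baseline that does
not depend on the state and the action. -/
theorem ae_limsup_enorm_ghat_sub_gradF_le_Qhat (k : Fin (K + 1)) {T : ℕ → ℕ}
    (hT : Tendsto T atTop atTop) :
    ∀ᵐ ω ∂P, (∃ b : ℝ, ∀ i x a, |π.Qhat k (R.θ i ω) (R.fhat i ω k) (T i) x a| ≤ b) →
      limsup (fun i => ‖R.ghat i ω k - π.gradF Θ k (R.θ i ω)‖ₑ) atTop ≤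
        ENNReal.ofReal C * limsup (fun i => ⨆ x, ⨆ a, ‖Qnet k (R.w i ω k) x a -
          π.Qhat k (R.θ i ω) (R.fhat i ω k) (T i) x a‖ₑ) atTop := by
  obtain ⟨τ, hτ, hQτ⟩ := hM.exists_norm_Q_sub_Qhat_le k
  obtain ⟨bQ, hbQ⟩ := (hM.isRegular_valueAt k).exists_norm_le
  obtain ⟨bτ, hbτ⟩ := hτ.bddAbove_range
  obtain ⟨L, hL⟩ := hM.exists_lipschitzWith_fdot k
  set δ : ℕ → Ω → ℝ := fun i ω => T i * (π.fdot k (R.θ i ω) - R.fhat i ω k)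
  have hδ (i : ℕ) : Measurable[R.ℱ (i * B)] (δ i) :=
    ((hL.continuous.measurable.comp (R.measurable_par hM hs i)).sub
      (R.measurable_fhat k i)).const_mul _
  have hdist (ω : Ω) (i : ℕ) (x : M.X) (a : M.A) : ‖π.Qhat k (R.θ i ω) (R.fhat i ω k) (T i) x a -
      π.Q k (R.θ i ω) x a - δ i ω‖ ≤ τ (T i) := by
    rw [π.Qhat_eq_add k _ _ (π.fdot k (R.θ i ω)), sub_right_comm, add_sub_cancel_right,
      norm_sub_rev]
    exact hQτ (R.par hM hs i ω) x a (T i)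
  filter_upwards [R.ae_exists_summable_smul_policyGradient_sub hM hs hB k,
    R.ae_summable_smul_score hM hs hB hδ] with ω ⟨r, hr, hgrad⟩ hscore ⟨b, hb⟩
  refine R.limsup_enorm_ghat_sub_gradF_le hM hs hC hB hr hgrad
    (hscore ⟨b + bQ + bτ, fun i => ?_⟩) (hτ.comp hT) (hdist ω)
  set x := R.x 0 ω
  set a := R.a 0 ω
  calc |δ i ω| = ‖π.Qhat k (R.θ i ω) (R.fhat i ω k) (T i) x a - π.Q k (R.θ i ω) x a -
        (π.Qhat k (R.θ i ω) (R.fhat i ω k) (T i) x a - π.Q k (R.θ i ω) x a - δ i ω)‖ := by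
        rw [sub_sub_cancel, Real.norm_eq_abs]
    _ ≤ b + bQ + bτ := (norm_sub_le _ _).trans (add_le_add ((norm_sub_le _ _).trans
        (add_le_add (hb i x a) (hbQ (R.par hM hs i ω) (x, a))))
        ((hdist ω i x a).trans (hbτ (mem_range_self (T i)))))

end Run

end CACRL

end

theorem lemma2_general {nS nZ nA K nθ : ℕ} (M : CACRL.CMDP nS nZ nA K) (π : CACRL.Policy M nθ)
    (Θ : Set (EuclideanSpace ℝ (Fin nθ))) (hM : CACRL.ProblemAssumptions M π Θ) :
    (∀ k, ∀ θ ∈ Θ, Tendsto (π.avgCost k θ) atTop (𝓝 (π.fdot k θ))) ∧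
    (∀ k, ∀ θ ∈ Θ, ∀ x a, Summable (fun l => π.costAt k θ x a l - π.fdot k θ)) ∧
    ∃ C : ℝ, 0 < C ∧
      ∀ (nω B : ℕ) (η μ : ℕ → ℝ) (ζ : Fin (K + 1) → ℝ)
        (Qnet : Fin (K + 1) → EuclideanSpace ℝ (Fin nω) → M.X → M.A → ℝ),
        0 < B → CACRL.TrackingSteps η μ →
      ∀ (Ω : Type*) [MeasurableSpace Ω] (P : Measure Ω) [IsProbabilityMeasure P]
        (R : CACRL.Run M π Θ B η μ ζ Qnet P) (k : Fin (K + 1)),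
        (∀ᵐ ω ∂P, Tendsto (fun i => |R.fhat i ω k - π.fdot k (R.θ i ω)|) atTop (𝓝 0)) ∧
        (∀ T : ℕ → ℕ, Tendsto T atTop atTop →
          ∀ᵐ ω ∂P,
            (∃ b : ℝ, ∀ i x a, |π.Qhat k (R.θ i ω) (R.fhat i ω k) (T i) x a| ≤ b) →
            limsup (fun i => ‖R.ghat i ω k - π.gradF Θ k (R.θ i ω)‖ₑ) atTop ≤
              ENNReal.ofReal C * limsup (fun i => ⨆ x, ⨆ a,
                ‖Qnet k (R.w i ω k) x a -
                  π.Qhat k (R.θ i ω) (R.fhat i ω k) (T i) x a‖ₑ) atTop) ∧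
        (∀ᵐ ω ∂P,
          limsup (fun i => ‖R.ghat i ω k - π.gradF Θ k (R.θ i ω)‖ₑ) atTop ≤
            ENNReal.ofReal C * limsup (fun i => ⨆ x, ⨆ a,
              ‖Qnet k (R.w i ω k) x a - π.Q k (R.θ i ω) x a‖ₑ) atTop) := by
  obtain ⟨b, hb⟩ := hM.isRegular_scoreAt.exists_norm_le
  have hC : ∀ θ y, ‖π.scoreAt Θ θ y‖ ≤ |b| + 1 := fun θ y =>
    (hb θ y).trans ((le_abs_self b).trans (lt_add_one _).le)
  refine ⟨fun k θ hθ => ?_, fun k θ hθ x a => hM.summable_costAt k ⟨θ, hθ⟩ x a, |b| + 1,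
    by positivity, fun nω B η μ ζ Qnet hB hs Ω _ P _ R k => ⟨?_, fun T hT => ?_, ?_⟩⟩
  · rw [hM.fdot_eq_integral k ⟨θ, hθ⟩]
    exact hM.tendsto_avgCost k ⟨θ, hθ⟩
  · exact R.ae_tendsto_fhat_sub_fdot hM hs hB k
  · exact R.ae_limsup_enorm_ghat_sub_gradF_le_Qhat hM hs hC hB k hT
  · exact R.ae_limsup_enorm_ghat_sub_gradF_le_Q hM hs hC hB k

theorem lemma2 {nS nZ nA K nθ : ℕ} (M : CACRL.CMDP nS nZ nA K) (π : CACRL.Policy M nθ)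
    (Θ : Set (EuclideanSpace ℝ (Fin nθ))) (hM : CACRL.ProblemAssumptions M π Θ) :
    -- the limits defining `ḟ_k` exist and the series defining `Q_k` converge
    (∀ k, ∀ θ ∈ Θ, Tendsto (π.avgCost k θ) atTop (𝓝 (π.fdot k θ))) ∧
    (∀ k, ∀ θ ∈ Θ, ∀ x a, Summable (fun l => π.costAt k θ x a l - π.fdot k θ)) ∧
    ∃ C : ℝ, 0 < C ∧
      ∀ (nω B : ℕ) (η μ : ℕ → ℝ) (ζ : Fin (K + 1) → ℝ)
        (Qnet : Fin (K + 1) → EuclideanSpace ℝ (Fin nω) → M.X → M.A → ℝ),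
        0 < B → CACRL.StepSizeAssumptions η μ → (∀ k, 0 < ζ k) →
      ∀ (Ω : Type*) [MeasurableSpace Ω] (P : Measure Ω) [IsProbabilityMeasure P]
        (R : CACRL.Run M π Θ B η μ ζ Qnet P) (k : Fin (K + 1)),
        -- consistency of the function values
        (∀ᵐ ω ∂P, Tendsto (fun i => |R.fhat i ω k - π.fdot k (R.θ i ω)|) atTop (𝓝 0)) ∧
        -- consistency of the gradients up to the error of the Q-networks relative to the
        -- surrogate value functions with estimate `f̂_{k,i}`, along any horizons `T_i → ∞`
        (∀ T : ℕ → ℕ, Tendsto T atTop atTop →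
          ∀ᵐ ω ∂P,
            (∃ b : ℝ, ∀ i x a, |π.Qhat k (R.θ i ω) (R.fhat i ω k) (T i) x a| ≤ b) →
            limsup (fun i => ‖R.ghat i ω k - π.gradF Θ k (R.θ i ω)‖ₑ) atTop ≤
              ENNReal.ofReal C * limsup (fun i => ⨆ x, ⨆ a,
                ‖Qnet k (R.w i ω k) x a -
                  π.Qhat k (R.θ i ω) (R.fhat i ω k) (T i) x a‖ₑ) atTop) ∧
        -- the same relative to the exact value functions
        (∀ᵐ ω ∂P,
          limsup (fun i => ‖R.ghat i ω k - π.gradF Θ k (R.θ i ω)‖ₑ) atTop ≤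
            ENNReal.ofReal C * limsup (fun i => ⨆ x, ⨆ a,
              ‖Qnet k (R.w i ω k) x a - π.Q k (R.θ i ω) x a‖ₑ) atTop) := by
  obtain ⟨hcost, hvalue, C, hC, h⟩ := lemma2_general M π Θ hM
  exact ⟨hcost, hvalue, C, hC, fun nω B η μ ζ Qnet hB hs _ =>
    h nω B η μ ζ Qnet hB hs.trackingSteps⟩
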